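/- Let $\Gamma\subset\mathbb C^2$ be a lattice, let $A=\mathbb C^2/\Gamma$ be the corresponding complex torus of dimension two, and let $t:A\to A$ be a biholomorphic automorphism of order three which has the origin as an isolated fixed point and satisfies $t^*(dz_1\wedge dz_2)=dz_1\wedge dz_2$. Let $\mathrm{Pic}(A)=H^1(A,\mathcal O_A^*)$ be the group of isomorphism classes of holomorphic line bundles on $A$ and $\mathrm{Pic}^0(A)$ the subgroup of the classes of topologically trivial line bundles (those with vanishing first Chern class). Then the group $$\mathrm{Pic}(A)/\mathrm{Pic}^0(A)$$ has rank at least two. Moreover, $t$ induces a unique homomorphism $t_*$ of $H_1(A,\mathbb Z)=\Gamma$, and hence acts on $H^2(A,\mathbb Z)$, the group of alternating forms $E:\Gamma\times\Gamma\to\mathbb Z$, by $(t^*E)(\gamma,\delta)=E(t_*\gamma,t_*\delta)$. Let $L_A\subset H^2(A,\mathbb Z)$ be the sublattice of the $t$-invariant classes and $L_A^\perp$ its orthogonal complement in $H^2(A,\mathbb Z)$ with respect to the intersection form $(E,E')\mapsto E\wedge E'\in H^4(A,\mathbb Z)=\mathbb Z$, where $A$ carries the orientation given by its complex structure. Then $L_A^\perp$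 has rank two, it is negative definite, and each of its elements $E$ is of type $(1,1)$, that is, the $\mathbb R$-bilinear extension of $E$ to $\mathbb C^2=\Gamma\otimes\mathbb R$ satisfies $E(iu,iv)=E(u,v)$ for all $u,v\in\mathbb C^2$. -/

import Mathlib

open Filter Topology

namespace ComplexTwoTorus

/-- The complex torus `ℂ² / Γ`, as a topological abelian group. -/
abbrev Torus (Γ : Submodule ℤ (Fin 2 → ℂ)) : Type := (Fin 2 → ℂ) ⧸ Γ

/-- The universal covering `ℂ² → ℂ² / Γ`. -/
def proj (Γ : Submodule ℤ (Fin 2 → ℂ)) (v : Fin 2 → ℂ) : Torus Γ := Submodule.Quotient.mk v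

/-! ### Holomorphic self-maps of the torus and the constant 2-form -/

/-- `F` is a holomorphic lift of `s : ℂ²/Γ → ℂ²/Γ` to the universal covering, over the open
set `W ⊆ ℂ²`. -/
def IsHolomorphicLiftOn (Γ : Submodule ℤ (Fin 2 → ℂ)) (s : Torus Γ → Torus Γ)
    (F : (Fin 2 → ℂ) → (Fin 2 → ℂ)) (W : Set (Fin 2 → ℂ)) : Prop :=
  IsOpen W ∧ DifferentiableOn ℂ F W ∧ ∀ w ∈ W, proj Γ (F w) = s (proj Γ w)

/-- A map `ℂ²/Γ → ℂ²/Γ` is holomorphic if near every point it has a holomorphic lift to the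
universal covering (which provides the holomorphic charts of the torus). -/
def IsHolomorphicMap (Γ : Submodule ℤ (Fin 2 → ℂ)) (s : Torus Γ → Torus Γ) : Prop :=
  ∀ v : Fin 2 → ℂ, ∃ F W, v ∈ W ∧ IsHolomorphicLiftOn Γ s F W

/-- The constant 2-form `dz₁ ∧ dz₂` on `ℂ²`. -/
def dz₁dz₂ (u w : Fin 2 → ℂ) : ℂ := u 0 * w 1 - u 1 * w 0

/-- The holomorphic map `s` pulls the 2-form induced by `dz₁ ∧ dz₂` on the torus back to itself;
the pull-back is computed in local holomorphic lifts. -/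
def PreservesHolomorphicTwoForm (Γ : Submodule ℤ (Fin 2 → ℂ)) (s : Torus Γ → Torus Γ) : Prop :=
  ∀ F W, IsHolomorphicLiftOn Γ s F W → ∀ v ∈ W, ∀ u w : Fin 2 → ℂ,
    dz₁dz₂ (fderiv ℂ F v u) (fderiv ℂ F v w) = dz₁dz₂ u w

/-- `t` is a (biholomorphic) automorphism of order three of the complex torus `ℂ²/Γ`, having the
origin as an isolated fixed point and leaving the 2-form `dz₁ ∧ dz₂` invariant. -/
structure IsSymplecticOrderThree (Γ : Submodule ℤ (Fin 2 → ℂ)) (t : Equiv.Perm (Torus Γ)) :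
    Prop where
  holomorphic : IsHolomorphicMap Γ t
  holomorphic_symm : IsHolomorphicMap Γ t.symm
  order_three : orderOf t = 3
  fixes_origin : t 0 = 0
  origin_isolated : ∀ᶠ x in 𝓝[≠] (0 : Torus Γ), t x ≠ x
  preserves_form : PreservesHolomorphicTwoForm Γ t

/-! ### The lattice `H²(A, ℤ)` -/

/-- `τ` is the map induced by `t` on `H₁(ℂ²/Γ, ℤ) = Γ`: some continuous lift `F` of `t` to the
universal covering satisfies `F (v + γ) = F v + τ γ`. -/
def IsInducedOnH₁ (Γ : Submodule ℤ (Fin 2 → ℂ)) (t : Torus Γ → Torus Γ) (τ : Γ →ₗ[ℤ] Γ) : Prop :=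
  ∃ F : (Fin 2 → ℂ) → (Fin 2 → ℂ), Continuous F ∧ (∀ v, proj Γ (F v) = t (proj Γ v)) ∧
    ∀ (v : Fin 2 → ℂ) (γ : Γ), F (v + γ) = F v + τ γ

/-- `H²(ℂ²/Γ, ℤ) = Hom(⋀² H₁(ℂ²/Γ, ℤ), ℤ)`: the alternating integral forms on `Γ`. -/
abbrev H2 (Γ : Submodule ℤ (Fin 2 → ℂ)) : Type := Γ [⋀^Fin 2]→ₗ[ℤ] ℤ

/-- The value of the alternating 4-form `E ∧ E'` (the cup product of `E` and `E'`) at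
`b 0, b 1, b 2, b 3`. -/
def wedge (Γ : Submodule ℤ (Fin 2 → ℂ)) (E E' : H2 Γ) (b : Fin 4 → Γ) : ℤ :=
  E ![b 0, b 1] * E' ![b 2, b 3] - E ![b 0, b 2] * E' ![b 1, b 3]
    + E ![b 0, b 3] * E' ![b 1, b 2] + E ![b 1, b 2] * E' ![b 0, b 3]
    - E ![b 1, b 3] * E' ![b 0, b 2] + E ![b 2, b 3] * E' ![b 0, b 1]

/-- The real coordinates `(x₁, y₁, x₂, y₂)` of `(x₁ + i y₁, x₂ + i y₂) ∈ ℂ²`. -/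
def realCoords (v : Fin 2 → ℂ) : Fin 4 → ℝ := ![(v 0).re, (v 0).im, (v 1).re, (v 1).im]

/-- A `ℤ`-basis of `Γ` is positively oriented for the natural orientation of `ℂ²`. The value
`wedge Γ E E' b` at such a basis is the intersection number of `E` and `E'`. -/
def IsPositivelyOriented (Γ : Submodule ℤ (Fin 2 → ℂ)) (b : Module.Basis (Fin 4) ℤ Γ) : Prop :=
  0 < Matrix.det (Matrix.of fun i => realCoords (b i : Fin 2 → ℂ))

/-- The lattice `L_A` of the `t`-invariant classes in `H²(ℂ²/Γ, ℤ)`, where `t` acts on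
`H₁(ℂ²/Γ, ℤ) = Γ` by `τ`. -/
def invariantClasses (Γ : Submodule ℤ (Fin 2 → ℂ)) (τ : Γ →ₗ[ℤ] Γ) : Submodule ℤ (H2 Γ) where
  carrier := {E | E.compLinearMap τ = E}
  add_mem' := by
    intro a b ha hb
    simp only [Set.mem_ofPred_eq] at *
    rw [AlternatingMap.add_compLinearMap, ha, hb]
  zero_mem' := by
    simp only [Set.mem_ofPred_eq]
    exact AlternatingMap.zero_compLinearMap τ
  smul_mem' := by
    intro c a ha
    simp only [Set.mem_ofPred_eq] at *
    ext v
    have h := congrArg (fun E : H2 Γ => E v) ha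
    simp only [AlternatingMap.compLinearMap_apply] at h
    simp [h]

/-- The orthogonal complement of `L` in `H²(ℂ²/Γ, ℤ)` for the intersection form. -/
def orthogonalComplement (Γ : Submodule ℤ (Fin 2 → ℂ)) (L : Submodule ℤ (H2 Γ)) :
    Submodule ℤ (H2 Γ) where
  carrier := {E | ∀ E' ∈ L, ∀ b : Fin 4 → Γ, wedge Γ E E' b = 0}
  add_mem' := by
    intro a b ha hb E' hE' v
    have h1 := ha E' hE' v
    have h2 := hb E' hE' v
    simp only [wedge, AlternatingMap.add_apply] at *
    linear_combination h1 + h2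
  zero_mem' := by
    intro E' _ v
    simp [wedge]
  smul_mem' := by
    intro c a ha E' hE' v
    have h1 := ha E' hE' v
    simp only [wedge, AlternatingMap.smul_apply, smul_eq_mul] at *
    linear_combination c * h1

/-- `E` is of type `(1,1)`: its `ℝ`-bilinear extension `B` to `ℂ² = H₁(ℂ²/Γ, ℝ)` satisfies
`B(iu, iv) = B(u, v)`. -/
def IsTypeOneOne (Γ : Submodule ℤ (Fin 2 → ℂ)) (E : H2 Γ) : Prop :=
  ∃ B : (Fin 2 → ℂ) →ₗ[ℝ] (Fin 2 → ℂ) →ₗ[ℝ] ℝ,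
    (∀ γ δ : Γ, B γ δ = (E ![γ, δ] : ℝ)) ∧
      ∀ u v, B (Complex.I • u) (Complex.I • v) = B u v

/-! ### The Picard group

Holomorphic line bundles are described by transition functions. Every open covering of `A = ℂ²/Γ`
is refined by one of the form `(U x)` indexed by the points `x` of `A`, with `x ∈ U x`, so
`H¹(A, 𝒪*)` is the group of the holomorphic 1-cocycles for such coverings, modulo shrinking the
covering and modulo coboundaries. A cocycle is represented by a family of functions `g x y`
on all of `A`, of which only the values on `U x ∩ U y`, for small neighbourhoods `U x`, matter. -/

/-- `f` is holomorphic on the open subset `U` of the torus. -/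
def IsHolomorphicOn (Γ : Submodule ℤ (Fin 2 → ℂ)) (f : Torus Γ → ℂˣ) (U : Set (Torus Γ)) : Prop :=
  DifferentiableOn ℂ (fun v => (f (proj Γ v) : ℂ)) (proj Γ ⁻¹' U)

/-- An open covering indexed by the points. -/
def IsPointedCover (Γ : Submodule ℤ (Fin 2 → ℂ)) (U : Torus Γ → Set (Torus Γ)) : Prop :=
  ∀ x, IsOpen (U x) ∧ x ∈ U x

theorem IsPointedCover.inter {Γ : Submodule ℤ (Fin 2 → ℂ)} {U U' : Torus Γ → Set (Torus Γ)}
    (h : IsPointedCover Γ U) (h' : IsPointedCover Γ U') :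
    IsPointedCover Γ (fun x => U x ∩ U' x) :=
  fun x => ⟨(h x).1.inter (h' x).1, (h x).2, (h' x).2⟩

theorem isPointedCover_univ (Γ : Submodule ℤ (Fin 2 → ℂ)) :
    IsPointedCover Γ (fun _ => Set.univ) :=
  fun _ => ⟨isOpen_univ, trivial⟩

/-- Holomorphic transition functions of line bundles. -/
def holomorphicCocycles (Γ : Submodule ℤ (Fin 2 → ℂ)) :
    Subgroup (Torus Γ → Torus Γ → Torus Γ → ℂˣ) where
  carrier := {g | ∃ U, IsPointedCover Γ U ∧
    (∀ x y, IsHolomorphicOn Γ (g x y) (U x ∩ U y)) ∧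
    ∀ x y z, ∀ p ∈ U x ∩ U y ∩ U z, g x y p * g y z p = g x z p}
  mul_mem' := by
    rintro g g' ⟨U, hU, h1, h2⟩ ⟨U', hU', h1', h2'⟩
    refine ⟨_, hU.inter hU', fun x y => ?_, fun x y z p hp => ?_⟩
    · simpa [IsHolomorphicOn] using
        DifferentiableOn.fun_mul ((h1 x y).mono fun v hv => ⟨hv.1.1, hv.2.1⟩)
          ((h1' x y).mono fun v hv => ⟨hv.1.2, hv.2.2⟩)
    · simp only [Pi.mul_apply]
      rw [← h2 x y z p ⟨⟨hp.1.1.1, hp.1.2.1⟩, hp.2.1⟩, ← h2' x y z p ⟨⟨hp.1.1.2, hp.1.2.2⟩, hp.2.2⟩,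
        mul_mul_mul_comm]
  one_mem' := by
    refine ⟨_, isPointedCover_univ Γ, fun x y => ?_, fun x y z p _ => ?_⟩
    · simp [IsHolomorphicOn]
    · simp
  inv_mem' := by
    rintro g ⟨U, hU, h1, h2⟩
    refine ⟨U, hU, fun x y => ?_, fun x y z p hp => ?_⟩
    · simpa [IsHolomorphicOn] using
        DifferentiableOn.fun_inv (h1 x y) fun v _ => (g x y (proj Γ v)).ne_zero
    · simp only [Pi.inv_apply]
      rw [← h2 x y z p hp, mul_inv]

/-- Transition functions of holomorphically trivial line bundles: coboundaries of systems of
nowhere vanishing holomorphic functions `h x` on `U x`. -/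
def holomorphicCoboundaries (Γ : Submodule ℤ (Fin 2 → ℂ)) :
    Subgroup (Torus Γ → Torus Γ → Torus Γ → ℂˣ) where
  carrier := {g | ∃ U, IsPointedCover Γ U ∧ ∃ h : Torus Γ → Torus Γ → ℂˣ,
    (∀ x, IsHolomorphicOn Γ (h x) (U x)) ∧
    ∀ x y, ∀ p ∈ U x ∩ U y, g x y p = h x p / h y p}
  mul_mem' := by
    rintro g g' ⟨U, hU, h, h1, h2⟩ ⟨U', hU', h', h1', h2'⟩
    refine ⟨_, hU.inter hU', h * h', fun x => ?_, fun x y p hp => ?_⟩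
    · simpa [IsHolomorphicOn] using
        DifferentiableOn.fun_mul ((h1 x).mono fun v hv => hv.1) ((h1' x).mono fun v hv => hv.2)
    · simp only [Pi.mul_apply]
      rw [h2 x y p ⟨hp.1.1, hp.2.1⟩, h2' x y p ⟨hp.1.2, hp.2.2⟩, div_mul_div_comm]
  one_mem' := by
    refine ⟨_, isPointedCover_univ Γ, 1, fun x => ?_, fun x y p _ => ?_⟩
    · simp [IsHolomorphicOn]
    · simp
  inv_mem' := by
    rintro g ⟨U, hU, h, h1, h2⟩
    refine ⟨U, hU, h⁻¹, fun x => ?_, fun x y p hp => ?_⟩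
    · simpa [IsHolomorphicOn] using
        DifferentiableOn.fun_inv (h1 x) fun v _ => (h x (proj Γ v)).ne_zero
    · simp only [Pi.inv_apply]
      rw [h2 x y p hp, inv_div, inv_div_inv]

theorem holomorphicCoboundaries_le (Γ : Submodule ℤ (Fin 2 → ℂ)) :
    holomorphicCoboundaries Γ ≤ holomorphicCocycles Γ := by
  rintro g ⟨U, hU, h, h1, h2⟩
  refine ⟨U, hU, fun x y => ?_, fun x y z p hp => ?_⟩
  · refine DifferentiableOn.congr (f := fun v => (h x (proj Γ v) : ℂ) * (h y (proj Γ v) : ℂ)⁻¹)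
      (DifferentiableOn.fun_mul ((h1 x).mono fun v hv => hv.1)
        (DifferentiableOn.fun_inv ((h1 y).mono fun v hv => hv.2)
          fun v _ => (h y (proj Γ v)).ne_zero)) fun v hv => ?_
    rw [h2 x y _ hv, Units.val_div_eq_div_val, div_eq_mul_inv]
  · rw [h2 x y p hp.1, h2 y z p ⟨hp.1.2, hp.2⟩, h2 x z p ⟨hp.1.1, hp.2⟩, div_mul_div_cancel]

/-- Transition functions of topologically trivial line bundles: coboundaries of systems of
nowhere vanishing continuous functions `h x` on `U x`. -/
def continuousCoboundaries (Γ : Submodule ℤ (Fin 2 → ℂ)) :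
    Subgroup (Torus Γ → Torus Γ → Torus Γ → ℂˣ) where
  carrier := {g | ∃ U, IsPointedCover Γ U ∧ ∃ h : Torus Γ → Torus Γ → ℂˣ,
    (∀ x, ContinuousOn (h x) (U x)) ∧
    ∀ x y, ∀ p ∈ U x ∩ U y, g x y p = h x p / h y p}
  mul_mem' := by
    rintro g g' ⟨U, hU, h, h1, h2⟩ ⟨U', hU', h', h1', h2'⟩
    refine ⟨_, hU.inter hU', h * h', fun x => ?_, fun x y p hp => ?_⟩
    · exact ((h1 x).mono fun v hv => hv.1).mul ((h1' x).mono fun v hv => hv.2)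
    · simp only [Pi.mul_apply]
      rw [h2 x y p ⟨hp.1.1, hp.2.1⟩, h2' x y p ⟨hp.1.2, hp.2.2⟩, div_mul_div_comm]
  one_mem' :=
    ⟨_, isPointedCover_univ Γ, 1, fun _ => continuousOn_const, fun x y p _ => by simp⟩
  inv_mem' := by
    rintro g ⟨U, hU, h, h1, h2⟩
    refine ⟨U, hU, h⁻¹, fun x => (h1 x).inv, fun x y p hp => ?_⟩
    simp only [Pi.inv_apply]
    rw [h2 x y p hp, inv_div, inv_div_inv]

/-- The Picard group `Pic(A) = H¹(A, 𝒪*)` of `A = ℂ²/Γ`: isomorphism classes of holomorphic line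
bundles under the tensor product. -/
def Pic (Γ : Submodule ℤ (Fin 2 → ℂ)) : Type :=
  holomorphicCocycles Γ ⧸ (holomorphicCoboundaries Γ).subgroupOf (holomorphicCocycles Γ)

noncomputable instance Pic.instCommGroup (Γ : Submodule ℤ (Fin 2 → ℂ)) : CommGroup (Pic Γ) :=
  QuotientGroup.Quotient.commGroup
    ((holomorphicCoboundaries Γ).subgroupOf (holomorphicCocycles Γ))

/-- The class of the line bundle with the given transition functions. -/
noncomputable def Pic.mk (Γ : Submodule ℤ (Fin 2 → ℂ)) : holomorphicCocycles Γ →* Pic Γ :=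
  QuotientGroup.mk' ((holomorphicCoboundaries Γ).subgroupOf (holomorphicCocycles Γ))

/-- `Pic⁰(A)`: the classes of the topologically trivial holomorphic line bundles, that is, of those
with vanishing first Chern class. -/
noncomputable def Pic₀ (Γ : Submodule ℤ (Fin 2 → ℂ)) : Subgroup (Pic Γ) :=
  ((continuousCoboundaries Γ).subgroupOf (holomorphicCocycles Γ)).map (Pic.mk Γ)

/-- The Néron-Severi group `Pic(A) / Pic⁰(A)`. -/
def NeronSeveri (Γ : Submodule ℤ (Fin 2 → ℂ)) : Type := Pic Γ ⧸ Pic₀ Γ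

noncomputable instance NeronSeveri.instCommGroup (Γ : Submodule ℤ (Fin 2 → ℂ)) :
    CommGroup (NeronSeveri Γ) :=
  QuotientGroup.Quotient.commGroup (Pic₀ Γ)

end ComplexTwoTorus

/-! By Liouville, `t` lifts to a linear map `A` of ℂ² preserving Γ. The origin is an isolated fixed
point, so 1 is not an eigenvalue, and A³ = 1 gives A² + A + 1 = 0. Since det A = 1, `A` is not a
scalar, so its eigenvalues are ω and its conjugate ω̄, with linear eigenforms ℓ and m. On Γ ⊗ ℂ the
eigenvalue ω belongs to ℓ and m̄ and the eigenvalue ω̄ to ℓ̄ and m. The invariant 2-forms pair an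
ω-form with an ω̄-form, and their complement is spanned by ℓ ∧ m̄ and its conjugate, both of type
(1,1). An integral form of this description of the complement is that τ is self-adjoint for E: E(τx,
y) = E(x, τy) (`mem_orthogonalComplement_iff`). Choose e, f in Γ such that e, τe, f, τf span a
sublattice of finite index. Such an E is then determined by a = E(e, f) and c = E(e, τf), which
gives rank two. Moreover E ∧ E takes the value 2(a² + ac + c²) at this quadruple, which is
negatively oriented because m enters conjugated (`IsEigencoords.det_realCoords_neg`). Hence the
complement is negative definite. For the rank of Pic/Pic⁰, each E in the complement gives the
explicit factor of automorphy with Chern class ±2E (`factorCocycle`). Its line bundle is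
topologically trivial only if E = 0, so the complement embeds in Pic/Pic⁰. -/

namespace ComplexTwoTorus

/-! ### The covering ℂ² → ℂ²/Γ and maps into the lattice -/

section Covering

variable (Γ : Submodule ℤ (Fin 2 → ℂ))

theorem proj_eq_iff {v w : Fin 2 → ℂ} : proj Γ v = proj Γ w ↔ v - w ∈ Γ :=
  Submodule.Quotient.eq Γ

theorem proj_add_mem (v : Fin 2 → ℂ) {γ : Fin 2 → ℂ} (hγ : γ ∈ Γ) : proj Γ (v + γ) = proj Γ v :=
  (proj_eq_iff Γ).2 (by simpa using hγ)

theorem proj_zero : proj Γ 0 = 0 := rfl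

theorem proj_surjective : Function.Surjective (proj Γ) :=
  Submodule.Quotient.mk_surjective Γ

theorem isQuotientMap_proj : IsQuotientMap (proj Γ) := isQuotientMap_quot_mk

theorem isOpenMap_proj : IsOpenMap (proj Γ) :=
  QuotientAddGroup.isOpenMap_coe (N := Γ.toAddSubgroup)

theorem continuous_proj : Continuous (proj Γ) := (isQuotientMap_proj Γ).continuous

variable [DiscreteTopology Γ]

theorem isCoveringMap_proj : IsCoveringMap (proj Γ) :=
  ((isQuotientMap_proj Γ).isAddQuotientCoveringMap_of_addSubgroup Γ.toAddSubgroup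
    (by exact ⟨(inferInstance : DiscreteTopology Γ)⟩) (by
      intro v w
      rw [eq_comm, proj_eq_iff, sub_eq_add_neg]; rfl)).isCoveringMap

/-- ℂ² is connected and Γ discrete. This turns congruences modulo Γ between continuous maps into
identities up to a constant. -/
theorem eq_of_continuous_of_mem {g : (Fin 2 → ℂ) → (Fin 2 → ℂ)} (hg : Continuous g)
    (h : ∀ v, g v ∈ Γ) (v w : Fin 2 → ℂ) : g v = g w :=
  congrArg Subtype.val (PreconnectedSpace.constant (f := fun v => (⟨g v, h v⟩ : Γ)) inferInstance
    (hg.subtype_mk h) (x := v) (y := w))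

theorem exists_pos_norm_lt_imp_eq_zero :
    ∃ r > 0, ∀ γ ∈ Γ, ‖γ‖ < r → γ = 0 := by
  have h : {(0 : Γ)} ∈ 𝓝 (0 : Γ) := (isOpen_discrete _).mem_nhds rfl
  obtain ⟨r, hr, h⟩ := Metric.mem_nhds_iff.1 h
  refine ⟨r, hr, fun γ hγ hn => ?_⟩
  have : (⟨γ, hγ⟩ : Γ) ∈ ({0} : Set Γ) := h (by simpa [Subtype.dist_eq] using hn)
  simpa using this

/-- A continuous map into the lattice near a point is locally constant. -/
theorem eventually_eq_of_continuousAt_of_mem {g : (Fin 2 → ℂ) → (Fin 2 → ℂ)} {v : Fin 2 → ℂ}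
    (hg : ContinuousAt g v) (h : ∀ᶠ w in 𝓝 v, g w ∈ Γ) : ∀ᶠ w in 𝓝 v, g w = g v := by
  obtain ⟨r, hr, h0⟩ := exists_pos_norm_lt_imp_eq_zero Γ
  filter_upwards [h, hg (Metric.ball_mem_nhds _ hr)] with w hw hw'
  have := h0 _ (Γ.sub_mem hw h.self_of_nhds) (by simpa [dist_eq_norm] using hw')
  exact sub_eq_zero.1 this

end Covering

/-! ### Holomorphic maps of the torus fixing the origin are linear -/

section LinearLift

variable {Γ : Submodule ℤ (Fin 2 → ℂ)}

theorem IsHolomorphicMap.continuous {s : Torus Γ → Torus Γ} (hs : IsHolomorphicMap Γ s) :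
    Continuous s := by
  rw [(isQuotientMap_proj Γ).continuous_iff, continuous_iff_continuousAt]
  intro v
  obtain ⟨F, W, hv, hW, hF, h⟩ := hs v
  have hW' := hW.mem_nhds hv
  have : ContinuousAt (fun w => proj Γ (F w)) v :=
    (continuous_proj Γ).continuousAt.comp (hF.continuousOn.continuousAt hW')
  exact this.congr (by filter_upwards [hW'] with w hw using h w hw)

variable [DiscreteTopology Γ]

/-- Two continuous lifts differ locally by a constant lattice vector, and one of them is
holomorphic. -/
theorem IsHolomorphicMap.differentiable_of_lift {s : Torus Γ → Torus Γ}
    (hs : IsHolomorphicMap Γ s) {F : (Fin 2 → ℂ) → (Fin 2 → ℂ)} (hF : Continuous F)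
    (h : ∀ v, proj Γ (F v) = s (proj Γ v)) : Differentiable ℂ F := by
  intro v
  obtain ⟨G, W, hv, hW, hG, hGs⟩ := hs v
  have hW' := hW.mem_nhds hv
  have hGd := hG.differentiableAt hW'
  have := eventually_eq_of_continuousAt_of_mem Γ (g := fun w => F w - G w)
    (hF.continuousAt.sub hGd.continuousAt) (by
      filter_upwards [hW'] with w hw
      rw [← proj_eq_iff, h, hGs w hw])
  refine (hGd.add_const (F v - G v)).congr_of_eventuallyEq ?_
  filter_upwards [this] with w hw
  rw [← hw]; abel

variable [IsZLattice ℝ Γ]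

/-- For the lift F with F(0) = 0, each difference F(z + w) − F(z) is Γ-periodic in z, hence bounded
and entire, hence constant by Liouville. So F is additive and continuous, therefore real linear, and
equals its complex derivative at 0. -/
theorem IsHolomorphicMap.exists_linear_lift {s : Torus Γ → Torus Γ} (hs : IsHolomorphicMap Γ s)
    (h0 : s 0 = 0) :
    ∃ A : (Fin 2 → ℂ) →L[ℂ] (Fin 2 → ℂ), ∀ v, proj Γ (A v) = s (proj Γ v) := by
  obtain ⟨F, ⟨hF0, hF⟩, -⟩ := (isCoveringMap_proj Γ).existsUnique_continuousMap_lifts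
    ⟨fun v => s (proj Γ v), hs.continuous.comp (continuous_proj Γ)⟩
    (a₀ := (0 : Fin 2 → ℂ)) (e₀ := 0) (by simp [proj_zero, h0])
  have hF : ∀ v, proj Γ (F v) = s (proj Γ v) := fun v => congrFun hF v
  have hd := hs.differentiable_of_lift F.continuous hF
  have hadd : ∀ v w, F (v + w) = F v + F w := by
    intro v w
    have hb := IsZLattice.isCompact_range_of_periodic Γ (fun z => F (z + w) - F z)
      (by fun_prop) (by
        intro z γ hγ
        have := eq_of_continuous_of_mem Γ (g := fun z => F (z + γ) - F z) (by fun_prop)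
          (fun z => by rw [← proj_eq_iff, hF, hF, proj_add_mem Γ z hγ]) (z + w) z
        rw [show z + γ + w = z + w + γ by abel]
        exact sub_eq_sub_iff_sub_eq_sub.1 this)
    have := Differentiable.apply_eq_apply_of_bounded (f := fun z => F (z + w) - F z)
      ((hd.comp (differentiable_id.add_const w)).sub hd) hb.isBounded v 0
    simp only [zero_add, hF0, sub_zero] at this
    rw [← this]; abel
  refine ⟨fderiv ℂ F 0, fun v => ?_⟩
  rw [← hF]
  congr 1
  let f : (Fin 2 → ℂ) →L[ℝ] (Fin 2 → ℂ) :=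
    AddMonoidHom.toRealLinearMap (AddMonoidHom.mk' F hadd) F.continuous
  have h1 : HasFDerivAt F f 0 := f.hasFDerivAt
  have h2 : HasFDerivAt F ((fderiv ℂ F 0).restrictScalars ℝ) 0 :=
    (hd 0).hasFDerivAt.restrictScalars ℝ
  exact congrArg (fun g : (Fin 2 → ℂ) →L[ℝ] (Fin 2 → ℂ) => g v) (h2.unique h1)

end LinearLift

/-! ### Eigenvalues of the linear lift -/

/-- The primitive third root of unity in the upper half plane. -/
noncomputable def omega : ℂ := ⟨-1 / 2, √3 / 2⟩

open scoped ComplexConjugate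

theorem omega_sq : omega ^ 2 + omega + 1 = 0 := by
  have h : √3 * √3 = 3 := Real.mul_self_sqrt (by norm_num)
  apply Complex.ext
  · simp [omega, pow_two]; linarith
  · simp [omega, pow_two]; ring

theorem conj_omega : conj omega = -1 - omega := by
  apply Complex.ext <;> simp [omega]; norm_num

theorem omega_ne_conj : omega - conj omega ≠ 0 := by
  intro h
  have := congrArg Complex.im h
  simp [omega] at this

namespace IsSymplecticOrderThree

variable {Γ : Submodule ℤ (Fin 2 → ℂ)} [DiscreteTopology Γ] {t : Equiv.Perm (Torus Γ)}
  {A : (Fin 2 → ℂ) →L[ℂ] (Fin 2 → ℂ)}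

omit [DiscreteTopology Γ] in
theorem map_mem (ht : IsSymplecticOrderThree Γ t) (hA : ∀ v, proj Γ (A v) = t (proj Γ v))
    {γ : Fin 2 → ℂ} (hγ : γ ∈ Γ) : A γ ∈ Γ := by
  have : proj Γ γ = proj Γ 0 := (proj_eq_iff Γ).2 (by simpa using hγ)
  have h := hA γ
  rw [this, proj_zero, ht.fixes_origin, ← proj_zero, proj_eq_iff, sub_zero] at h
  exact h

theorem cube_eq (ht : IsSymplecticOrderThree Γ t) (hA : ∀ v, proj Γ (A v) = t (proj Γ v))
    (v : Fin 2 → ℂ) : A (A (A v)) = v := by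
  have h3 : t ^ 3 = 1 := ht.order_three ▸ pow_orderOf_eq_one t
  have := eq_of_continuous_of_mem Γ (g := fun v => A (A (A v)) - v) (by fun_prop)
    (fun v => by
      rw [← proj_eq_iff, hA, hA, hA]
      exact congrArg (fun s : Equiv.Perm (Torus Γ) => s (proj Γ v)) h3) v 0
  simpa [sub_eq_zero] using this

/-- If A fixes v ≠ 0, the images of v/(n + 1) are fixed points of `t` tending to the origin; they
are eventually different from it because Γ is discrete. -/
theorem eq_zero_of_fixed (ht : IsSymplecticOrderThree Γ t)
    (hA : ∀ v, proj Γ (A v) = t (proj Γ v)) {v : Fin 2 → ℂ} (hv : A v = v) : v = 0 := by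
  by_contra hne
  obtain ⟨r, hr, h0⟩ := exists_pos_norm_lt_imp_eq_zero Γ
  have hlim : Tendsto (fun n : ℕ => ((1 : ℝ) / ((n : ℝ) + 1)) • v) atTop (𝓝 0) := by
    simpa using (tendsto_one_div_add_atTop_nhds_zero_nat (𝕜 := ℝ)).smul_const v
  have hlim' : Tendsto (fun n : ℕ => proj Γ (((1 : ℝ) / ((n : ℝ) + 1)) • v)) atTop (𝓝 0) :=
    ((continuous_proj Γ).tendsto 0).comp hlim
  have h1 := hlim'.eventually (eventually_nhdsWithin_iff.1 ht.origin_isolated)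
  have h2 := hlim.eventually (Metric.ball_mem_nhds 0 hr)
  obtain ⟨n, hn1, hn2⟩ := (h1.and h2).exists
  refine hn1 ?_ ?_
  · intro h
    have h := h0 _ (by simpa using (proj_eq_iff Γ).1 (h.trans (proj_zero Γ).symm))
      (by simpa [dist_eq_norm] using hn2)
    rcases smul_eq_zero.1 h with h | h
    · exact (by positivity : (0 : ℝ) < ((n : ℝ) + 1)⁻¹).ne' (by simpa using h)
    · exact hne h
  · rw [← hA, ← Complex.coe_smul, map_smul, hv]

theorem sq_add (ht : IsSymplecticOrderThree Γ t) (hA : ∀ v, proj Γ (A v) = t (proj Γ v))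
    (v : Fin 2 → ℂ) : A (A v) = -v - A v := by
  -- Since A³ = 1, this orbit sum is fixed by A.
  have : A (A v) + A v + v = 0 := ht.eq_zero_of_fixed hA (by
    rw [map_add, map_add, ht.cube_eq hA]; abel)
  linear_combination (exp := 1) this

omit [DiscreteTopology Γ] in
theorem dz₁dz₂_map (ht : IsSymplecticOrderThree Γ t) (hA : ∀ v, proj Γ (A v) = t (proj Γ v))
    (u w : Fin 2 → ℂ) : dz₁dz₂ (A u) (A w) = dz₁dz₂ u w := by
  simpa using ht.preserves_form A Set.univ
    ⟨isOpen_univ, A.differentiable.differentiableOn, fun w _ => hA w⟩ 0 trivial u w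

/-- Either primitive third root of unity is an eigenvalue of the transpose of `A`. -/
theorem exists_eigenform (ht : IsSymplecticOrderThree Γ t)
    (hA : ∀ v, proj Γ (A v) = t (proj Γ v)) {ζ : ℂ} (hζ : ζ ^ 2 + ζ + 1 = 0) :
    ∃ ℓ : (Fin 2 → ℂ) →ₗ[ℂ] ℂ, ℓ ≠ 0 ∧ ∀ v, ℓ (A v) = ζ * ℓ v := by
  -- The other root is −1 − ζ, so A² + A + 1 = 0 factors as (A + 1 + ζ)(A − ζ) = 0: every row of A +
  -- 1 + ζ is an eigenform for ζ.
  have key : ∀ i, ∀ v, (LinearMap.proj i ∘ₗ ((A : (Fin 2 → ℂ) →ₗ[ℂ] (Fin 2 → ℂ)) +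
      (1 + ζ) • LinearMap.id) : (Fin 2 → ℂ) →ₗ[ℂ] ℂ) (A v) =
      ζ * (LinearMap.proj i ∘ₗ ((A : (Fin 2 → ℂ) →ₗ[ℂ] (Fin 2 → ℂ)) +
      (1 + ζ) • LinearMap.id) : (Fin 2 → ℂ) →ₗ[ℂ] ℂ) v := by
    intro i v
    simp [ht.sq_add hA v]
    linear_combination (-v i) * hζ
  by_contra! hcon
  have h0 : ∀ i, (LinearMap.proj i ∘ₗ ((A : (Fin 2 → ℂ) →ₗ[ℂ] (Fin 2 → ℂ)) +
      (1 + ζ) • LinearMap.id) : (Fin 2 → ℂ) →ₗ[ℂ] ℂ) = 0 := by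
    intro i
    by_contra h
    obtain ⟨v, hv⟩ := hcon _ h
    exact hv (key i v)
  -- If all rows vanish, A is the scalar −(1 + ζ), of determinant (1 + ζ)² = ζ; invariance of dz₁ ∧
  -- dz₂ then forces ζ = 1.
  have hAv : ∀ v i, A v i = -(1 + ζ) * v i := by
    intro v i
    have := congrArg (fun g => g v) (h0 i)
    simp at this
    linear_combination this
  have := ht.dz₁dz₂_map hA ![1, 0] ![0, 1]
  simp [dz₁dz₂, hAv] at this
  have hζ1 : ζ = 1 := by linear_combination this - hζ
  rw [hζ1] at hζ
  norm_num at hζ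

end IsSymplecticOrderThree

/-- `ℓ` and `m` are linear forms diagonalizing `A`, with eigenvalues `omega` and its conjugate. -/
structure IsEigencoords (A : (Fin 2 → ℂ) →L[ℂ] (Fin 2 → ℂ)) (ℓ m : (Fin 2 → ℂ) →ₗ[ℂ] ℂ) :
    Prop where
  fst_ne_zero : ℓ ≠ 0
  snd_ne_zero : m ≠ 0
  fst_map : ∀ v, ℓ (A v) = omega * ℓ v
  snd_map : ∀ v, m (A v) = conj omega * m v

theorem IsSymplecticOrderThree.exists_eigencoords {Γ : Submodule ℤ (Fin 2 → ℂ)}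
    [DiscreteTopology Γ] {t : Equiv.Perm (Torus Γ)} {A : (Fin 2 → ℂ) →L[ℂ] (Fin 2 → ℂ)}
    (ht : IsSymplecticOrderThree Γ t) (hA : ∀ v, proj Γ (A v) = t (proj Γ v)) :
    ∃ ℓ m, IsEigencoords A ℓ m := by
  obtain ⟨ℓ, h1, h2⟩ := ht.exists_eigenform hA omega_sq
  obtain ⟨m, h3, h4⟩ := ht.exists_eigenform hA (ζ := conj omega) (by
    rw [conj_omega]; linear_combination omega_sq)
  exact ⟨ℓ, m, h1, h3, h2, h4⟩

namespace IsEigencoords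

theorem apply_eq (ℓ : (Fin 2 → ℂ) →ₗ[ℂ] ℂ) (v : Fin 2 → ℂ) :
    ℓ v = ℓ ![1, 0] * v 0 + ℓ ![0, 1] * v 1 := by
  have : v = v 0 • ![1, 0] + v 1 • ![0, 1] := by ext i; fin_cases i <;> simp
  conv_lhs => rw [this]
  rw [map_add, map_smul, map_smul, smul_eq_mul, smul_eq_mul, mul_comm, mul_comm (v 1)]

variable {A : (Fin 2 → ℂ) →L[ℂ] (Fin 2 → ℂ)} {ℓ m : (Fin 2 → ℂ) →ₗ[ℂ] ℂ}

/-- Eigenforms for distinct eigenvalues are independent: evaluate the relation at A v and eliminate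
ℓ. -/
theorem eq_zero_of_comb (h : IsEigencoords A ℓ m) {α β : ℂ} (hc : ∀ v, α * ℓ v + β * m v = 0) :
    β = 0 := by
  have : ∀ v, β * (omega - conj omega) * m v = 0 := fun v => by
    have h1 := hc (A v)
    rw [h.fst_map, h.snd_map] at h1
    linear_combination omega * hc v - h1
  by_contra hβ
  refine h.snd_ne_zero (LinearMap.ext fun v => ?_)
  simpa [hβ, omega_ne_conj] using this v

theorem det_ne_zero (h : IsEigencoords A ℓ m) :
    ℓ ![1, 0] * m ![0, 1] - ℓ ![0, 1] * m ![1, 0] ≠ 0 := by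
  intro h0
  have h1 : ℓ ![1, 0] = 0 := by
    refine h.eq_zero_of_comb (α := -m ![1, 0]) fun v => ?_
    rw [apply_eq ℓ v, apply_eq m v]
    linear_combination v 1 * h0
  have h2 : ℓ ![0, 1] = 0 := by
    refine h.eq_zero_of_comb (α := -m ![0, 1]) fun v => ?_
    rw [apply_eq ℓ v, apply_eq m v]
    linear_combination -v 0 * h0
  refine h.fst_ne_zero (LinearMap.ext fun v => ?_)
  rw [apply_eq ℓ v, h1, h2]; simp

end IsEigencoords

/-! ### The induced map on `H₁` -/

section Induced

variable {Γ : Submodule ℤ (Fin 2 → ℂ)} {t : Equiv.Perm (Torus Γ)}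
  {A : (Fin 2 → ℂ) →L[ℂ] (Fin 2 → ℂ)}

/-- A lift of `t` which is linear induces on `Γ` its restriction. -/
theorem IsInducedOnH₁.coe_eq [DiscreteTopology Γ] (hA : ∀ v, proj Γ (A v) = t (proj Γ v))
    {τ : Γ →ₗ[ℤ] Γ} (hτ : IsInducedOnH₁ Γ t τ) (γ : Γ) : (τ γ : Fin 2 → ℂ) = A γ := by
  obtain ⟨F, hF, hFt, hadd⟩ := hτ
  have := eq_of_continuous_of_mem Γ (g := fun v => F v - A v) (by fun_prop)
    (fun v => by rw [← proj_eq_iff, hFt, hA]) (0 + γ) 0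
  simp only [hadd, map_add] at this
  simp only [map_zero, zero_add, sub_zero] at this
  linear_combination (exp := 1) this

theorem existsUnique_isInducedOnH₁ [DiscreteTopology Γ] (ht : IsSymplecticOrderThree Γ t)
    (hA : ∀ v, proj Γ (A v) = t (proj Γ v)) :
    ∃! τ : Γ →ₗ[ℤ] Γ, IsInducedOnH₁ Γ t τ := by
  refine ⟨((A : (Fin 2 → ℂ) →ₗ[ℂ] (Fin 2 → ℂ)).restrictScalars ℤ).restrict
    fun γ hγ => ht.map_mem hA hγ, ⟨A, A.continuous, hA, fun v γ => ?_⟩, fun τ hτ => ?_⟩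
  · rw [map_add]; rfl
  · ext1 γ
    exact Subtype.ext (hτ.coe_eq hA γ)

end Induced

/-! ### Alternating forms on the lattice -/

section Forms

variable {Γ : Submodule ℤ (Fin 2 → ℂ)}

theorem update_pair_zero {α : Type*} (x y z : α) :
    Function.update ![x, y] 0 z = ![z, y] := by
  ext i; fin_cases i <;> rfl

theorem update_pair_one {α : Type*} (x y z : α) :
    Function.update ![x, y] 1 z = ![x, z] := by
  ext i; fin_cases i <;> rfl

/-- An alternating form as a bilinear map. -/
def bilin (E : H2 Γ) : Γ →ₗ[ℤ] Γ →ₗ[ℤ] ℤ :=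
  LinearMap.mk₂ ℤ (fun x y => E ![x, y])
    (fun x x' y => by
      simpa only [update_pair_zero] using E.map_update_add ![x, y] 0 x x')
    (fun c x y => by
      simpa only [update_pair_zero] using E.map_update_smul ![x, y] 0 c x)
    (fun x y y' => by
      simpa only [update_pair_one] using E.map_update_add ![x, y] 1 y y')
    (fun c x y => by
      simpa only [update_pair_one] using E.map_update_smul ![x, y] 1 c y)

theorem apply_eq_bilin (E : H2 Γ) (x y : Γ) : E ![x, y] = bilin E x y := rfl

theorem bilin_self (E : H2 Γ) (x : Γ) : bilin E x x = 0 :=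
  E.map_eq_zero_of_eq ![x, x] (i := 0) (j := 1) rfl (by decide)

theorem bilin_swap (E : H2 Γ) (x y : Γ) : bilin E x y = -bilin E y x := by
  have := bilin_self E (x + y)
  simp only [map_add, LinearMap.add_apply, bilin_self] at this
  linarith

theorem bilin_add (E E' : H2 Γ) : bilin (E + E') = bilin E + bilin E' := rfl

theorem bilin_sub (E E' : H2 Γ) : bilin (E - E') = bilin E - bilin E' := rfl

theorem bilin_smul (c : ℤ) (E : H2 Γ) : bilin (c • E) = c • bilin E := rfl

theorem bilin_injective : Function.Injective (bilin (Γ := Γ)) := by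
  intro E E' h
  ext w
  have : w = ![w 0, w 1] := by ext i; fin_cases i <;> rfl
  rw [this, apply_eq_bilin, apply_eq_bilin, h]

/-- The exterior product of two linear forms. -/
def wedgeForm (φ ψ : Γ →ₗ[ℤ] ℤ) : H2 Γ where
  toFun w := φ (w 0) * ψ (w 1) - φ (w 1) * ψ (w 0)
  map_update_add' := by
    intro inst w i x y
    obtain rfl : inst = instDecidableEqFin _ := Subsingleton.elim _ _
    fin_cases i <;> simp <;> ring
  map_update_smul' := by
    intro inst w i c x
    obtain rfl : inst = instDecidableEqFin _ := Subsingleton.elim _ _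
    fin_cases i <;> simp <;> ring
  map_eq_zero_of_eq' := by
    intro w i j h hij
    fin_cases i <;> fin_cases j <;> simp at hij h ⊢ <;> rw [h] <;> ring

@[simp]
theorem bilin_wedgeForm (φ ψ : Γ →ₗ[ℤ] ℤ) (x y : Γ) :
    bilin (wedgeForm φ ψ) x y = φ x * ψ y - φ y * ψ x := rfl

/-- `E ∧ E'` as an alternating map. -/
def wedgeAlt (E E' : H2 Γ) : Γ [⋀^Fin 4]→ₗ[ℤ] ℤ where
  toFun := wedge Γ E E'
  map_update_add' := by
    intro inst w i x y
    obtain rfl : inst = instDecidableEqFin _ := Subsingleton.elim _ _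
    fin_cases i <;> simp [wedge, apply_eq_bilin] <;> ring
  map_update_smul' := by
    intro inst w i c x
    obtain rfl : inst = instDecidableEqFin _ := Subsingleton.elim _ _
    fin_cases i <;> simp [wedge, apply_eq_bilin] <;> ring
  map_eq_zero_of_eq' := by
    intro w i j h hij
    wlog hlt : i < j generalizing i j
    · exact this j i h.symm hij.symm (lt_of_le_of_ne (not_lt.1 hlt) hij.symm)
    simp only [wedge, apply_eq_bilin]
    fin_cases i <;> fin_cases j <;> simp at hlt h ⊢ <;> rw [h] <;>
      simp only [bilin_self]
    · ring
    · rw [bilin_swap E (w 2) (w 1), bilin_swap E' (w 2) (w 1)]; ring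
    · rw [bilin_swap E (w 3) (w 1), bilin_swap E (w 3) (w 2), bilin_swap E' (w 3) (w 1),
        bilin_swap E' (w 3) (w 2)]; ring
    · ring
    · rw [bilin_swap E (w 2), bilin_swap E' (w 2)]; ring
    · ring

/-- Alternating 4-forms on a lattice of rank four are multiples of the determinant, so an
intersection number can be computed on any independent quadruple. -/
theorem wedge_eq_mul_det (E E' : H2 Γ) (b : Module.Basis (Fin 4) ℤ Γ) (v : Fin 4 → Γ) :
    wedge Γ E E' v = wedge Γ E E' b * b.det v :=
  congrArg (fun g : Γ [⋀^Fin 4]→ₗ[ℤ] ℤ => g v) ((wedgeAlt E E').eq_smul_basis_det b)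

/-! ### Linear forms and a system of maximal rank -/

/-- The coordinates with respect to the vectors `v`, multiplied by the index of their span. -/
noncomputable def cramerCoords (b : Module.Basis (Fin 4) ℤ Γ) (v : Fin 4 → Γ) :
    Γ →ₗ[ℤ] (Fin 4 → ℤ) :=
  (b.toMatrix v).cramer ∘ₗ b.equivFun.toLinearMap

variable (b : Module.Basis (Fin 4) ℤ Γ) (v : Fin 4 → Γ)

theorem sum_cramerCoords_smul (γ : Γ) : ∑ j, cramerCoords b v γ j • v j = b.det v • γ := by
  apply b.equivFun.injective
  have := Matrix.mulVec_cramer (b.toMatrix v) (b.equivFun γ)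
  rw [map_smul, Module.Basis.det_apply, ← this]
  ext i
  simp [cramerCoords, Matrix.mulVec, dotProduct, Module.Basis.toMatrix_apply, mul_comm]

theorem cramerCoords_apply_self (k : Fin 4) :
    cramerCoords b v (v k) = Pi.single k (b.det v) := by
  rw [Module.Basis.det_apply]
  exact Matrix.cramer_row_self (b.toMatrix v) (b.equivFun (v k)) k fun j => by
    simp [Module.Basis.toMatrix_apply]

variable {b v}

/-- The vectors span only a sublattice of finite index, but that suffices for a torsion-free target.
This avoids needing a basis of Γ adapted to τ. -/
theorem hom_ext_of_det_ne_zero (hd : b.det v ≠ 0) {M : Type*} [AddCommGroup M]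
    [IsAddTorsionFree M] {φ ψ : Γ →ₗ[ℤ] M} (h : ∀ k, φ (v k) = ψ (v k)) : φ = ψ := by
  ext1 γ
  refine zsmul_right_injective hd ?_
  simp only
  rw [← map_zsmul, ← map_zsmul, ← sum_cramerCoords_smul]
  simp [map_sum, h]

theorem bilin_ext_of_det_ne_zero (hd : b.det v ≠ 0)
    {B B' : Γ →ₗ[ℤ] Γ →ₗ[ℤ] ℤ}
    (h : ∀ j k, B (v j) (v k) = B' (v j) (v k)) : B = B' := by
  refine LinearMap.ext fun x => hom_ext_of_det_ne_zero hd fun k => ?_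
  exact LinearMap.congr_fun (hom_ext_of_det_ne_zero (φ := B.flip (v k)) (ψ := B'.flip (v k)) hd
    fun j => h j k) x

end Forms

/-! ### Forms and an endomorphism of order three -/

section OrderThree

variable {Γ : Submodule ℤ (Fin 2 → ℂ)}

theorem mem_invariantClasses_iff {τ : Γ →ₗ[ℤ] Γ} {E : H2 Γ} :
    E ∈ invariantClasses Γ τ ↔ ∀ x y, bilin E (τ x) (τ y) = bilin E x y := by
  have hcomp : ∀ x y, bilin (E.compLinearMap τ) x y = bilin E (τ x) (τ y) := fun x y => by
    rw [← apply_eq_bilin, ← apply_eq_bilin, AlternatingMap.compLinearMap_apply]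
    congr 1
    ext i; fin_cases i <;> rfl
  constructor
  · intro h x y
    rw [← hcomp, show E.compLinearMap τ = E from h]
  · intro h
    exact bilin_injective (LinearMap.ext₂ fun x y => by rw [hcomp, h])

variable {τ : Γ →ₗ[ℤ] Γ} {e f : Γ} {b : Module.Basis (Fin 4) ℤ Γ}

/-- The coordinates of `τ γ` in terms of those of `γ`. -/
theorem cramerCoords_map (hτ : ∀ γ, τ (τ γ) = -γ - τ γ) (hd : b.det ![e, τ e, f, τ f] ≠ 0)
    (γ : Γ) :
    cramerCoords b ![e, τ e, f, τ f] (τ γ) =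
      ![-cramerCoords b ![e, τ e, f, τ f] γ 1,
        cramerCoords b ![e, τ e, f, τ f] γ 0 - cramerCoords b ![e, τ e, f, τ f] γ 1,
        -cramerCoords b ![e, τ e, f, τ f] γ 3,
        cramerCoords b ![e, τ e, f, τ f] γ 2 - cramerCoords b ![e, τ e, f, τ f] γ 3] := by
  set v := ![e, τ e, f, τ f]
  set c := cramerCoords b v with hc
  have h0 : c e = Pi.single 0 (b.det v) := cramerCoords_apply_self b v 0
  have h1 : c (τ e) = Pi.single 1 (b.det v) := cramerCoords_apply_self b v 1
  have h2 : c f = Pi.single 2 (b.det v) := cramerCoords_apply_self b v 2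
  have h3 : c (τ f) = Pi.single 3 (b.det v) := cramerCoords_apply_self b v 3
  let p : Fin 4 → Γ →ₗ[ℤ] ℤ := fun i => LinearMap.proj i ∘ₗ c
  have key : LinearMap.pi ![-p 1, p 0 - p 1, -p 3, p 2 - p 3] = c ∘ₗ τ := by
    refine hom_ext_of_det_ne_zero hd fun k => ?_
    ext i
    fin_cases k <;> fin_cases i <;> simp [v, p, h0, h1, h2, h3, hτ]
  have := LinearMap.congr_fun key γ
  rw [LinearMap.comp_apply] at this
  rw [← this]
  ext i
  fin_cases i <;> simp [p]

/-- The values of a form `E` for which `τ` is self-adjoint. -/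
theorem values_of_selfAdjoint (hτ : ∀ γ, τ (τ γ) = -γ - τ γ) {E : H2 Γ}
    (hE : ∀ x y, bilin E (τ x) y = bilin E x (τ y)) :
    (bilin E e (τ e) = 0 ∧ bilin E f (τ f) = 0) ∧ bilin E (τ e) f = bilin E e (τ f) ∧
      bilin E (τ e) (τ f) = -bilin E e f - bilin E e (τ f) := by
  have h0 : ∀ x, bilin E x (τ x) = 0 := fun x => by
    have h1 := hE x x
    have h2 := bilin_swap E (τ x) x
    linarith
  refine ⟨⟨h0 e, h0 f⟩, hE e f, ?_⟩
  rw [hE, hτ]; simp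

/-- The result is twice the norm form of the Eisenstein integers, which is positive definite; this
is the source of definiteness on the complement. -/
theorem wedge_self_of_selfAdjoint (hτ : ∀ γ, τ (τ γ) = -γ - τ γ) {E : H2 Γ}
    (hE : ∀ x y, bilin E (τ x) y = bilin E x (τ y)) :
    wedge Γ E E ![e, τ e, f, τ f] =
      2 * (bilin E e f ^ 2 + bilin E e f * bilin E e (τ f) + bilin E e (τ f) ^ 2) := by
  obtain ⟨⟨h1, h2⟩, h3, h4⟩ := values_of_selfAdjoint (e := e) (f := f) hτ hE
  simp [wedge, apply_eq_bilin, h1, h2, h3, h4]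
  ring

/-- A form for which `τ` is self-adjoint is determined by two of its values. -/
theorem eq_of_selfAdjoint (hτ : ∀ γ, τ (τ γ) = -γ - τ γ) (hd : b.det ![e, τ e, f, τ f] ≠ 0)
    {E E' : H2 Γ} (hE : ∀ x y, bilin E (τ x) y = bilin E x (τ y))
    (hE' : ∀ x y, bilin E' (τ x) y = bilin E' x (τ y)) (h1 : bilin E e f = bilin E' e f)
    (h2 : bilin E e (τ f) = bilin E' e (τ f)) : E = E' := by
  obtain ⟨⟨a1, a2⟩, a3, a4⟩ := values_of_selfAdjoint (e := e) (f := f) hτ hE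
  obtain ⟨⟨b1, b2⟩, b3, b4⟩ := values_of_selfAdjoint (e := e) (f := f) hτ hE'
  refine bilin_injective (bilin_ext_of_det_ne_zero hd fun j k => ?_)
  wlog hlt : j ≤ k generalizing j k
  · rw [bilin_swap E, bilin_swap E', this _ _ (le_of_not_ge hlt)]
  fin_cases j <;> fin_cases k <;> simp at hlt ⊢ <;>
    simp only [bilin_self, a1, a2, a3, a4, b1, b2, b3, b4, h1, h2]

/-- Conceptually, self-adjointness and 1 + τ + τ² = 0 make the orbit sum of E under τ vanish, so E
is orthogonal to invariant forms. The computation needs invariance of E' only at (e, f) and (e, τf).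
-/
theorem wedge_eq_zero_of_invariant (hτ : ∀ γ, τ (τ γ) = -γ - τ γ)
    {E E' : H2 Γ} (hE : ∀ x y, bilin E (τ x) y = bilin E x (τ y))
    (hE' : ∀ x y, bilin E' (τ x) (τ y) = bilin E' x y) :
    wedge Γ E E' ![e, τ e, f, τ f] = 0 := by
  obtain ⟨⟨h1, h2⟩, h3, h4⟩ := values_of_selfAdjoint (e := e) (f := f) hτ hE
  have h5 := hE' e f
  have h6 := hE' e (τ f)
  rw [hτ] at h6
  simp only [map_sub, map_neg] at h6
  simp [wedge, apply_eq_bilin, h1, h2, h3, h4]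
  rw [h5] at h6 ⊢
  linear_combination (-bilin E e (τ f)) * h6

/-- The invariant forms used to test orthogonality. -/
theorem wedgeForm_comb_mem_invariantClasses (hτ : ∀ γ, τ (τ γ) = -γ - τ γ)
    (hd : b.det ![e, τ e, f, τ f] ≠ 0) (r s p q : ℤ) :
    let c : Fin 4 → Γ →ₗ[ℤ] ℤ := fun i =>
      LinearMap.proj i ∘ₗ cramerCoords b ![e, τ e, f, τ f]
    -- With x = c₀ + c₁ω and y = c₂ + c₃ω, both multiplied by ω under τ, the last two forms span the
    -- components of x ∧ ȳ, invariant because ωω̄ = 1.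
    r • wedgeForm (c 0) (c 1) + s • wedgeForm (c 2) (c 3) +
      p • (wedgeForm (c 0) (c 2) + wedgeForm (c 1) (c 3) - wedgeForm (c 1) (c 2)) +
      q • (wedgeForm (c 0) (c 3) - wedgeForm (c 1) (c 2)) ∈ invariantClasses Γ τ := by
  intro c
  rw [mem_invariantClasses_iff]
  intro x y
  simp [bilin_add, bilin_sub, bilin_smul, c, cramerCoords_map hτ hd]
  ring

/-- Testing E against the four invariant forms yields E(f, τf) = 0, E(e, τe) = 0 and the two
relations of `values_of_selfAdjoint` between its mixed values. These suffice to verify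
self-adjointness on the quadruple. -/
theorem selfAdjoint_of_mem_orthogonalComplement (hτ : ∀ γ, τ (τ γ) = -γ - τ γ)
    (hd : b.det ![e, τ e, f, τ f] ≠ 0) {E : H2 Γ}
    (hE : E ∈ orthogonalComplement Γ (invariantClasses Γ τ)) (x y : Γ) :
    bilin E (τ x) y = bilin E x (τ y) := by
  have key := fun r s p q => hE _ (wedgeForm_comb_mem_invariantClasses hτ hd r s p q)
    ![e, τ e, f, τ f]
  have h0 := cramerCoords_apply_self b ![e, τ e, f, τ f] 0
  have h1 := cramerCoords_apply_self b ![e, τ e, f, τ f] 1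
  have h2 := cramerCoords_apply_self b ![e, τ e, f, τ f] 2
  have h3 := cramerCoords_apply_self b ![e, τ e, f, τ f] 3
  simp at h0 h1 h2 h3
  have k1 := key 1 0 0 0
  have k2 := key 0 1 0 0
  have k3 := key 0 0 1 0
  have k4 := key 0 0 0 1
  simp [wedge, h0, h1, h2, h3, hd, apply_eq_bilin] at k1 k2 k3 k4
  have hd2 := mul_ne_zero hd hd
  have k5 : bilin E (τ e) (τ f) = -bilin E e f - bilin E e (τ f) :=
    mul_right_cancel₀ hd2 (by linear_combination -k3)
  have k6 : bilin E (τ e) f = bilin E e (τ f) :=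
    mul_right_cancel₀ hd2 (by linear_combination k4)
  have hB : bilin E ∘ₗ τ = (bilin E).compl₂ τ := by
    refine bilin_ext_of_det_ne_zero hd fun j k => ?_
    have a1 := bilin_swap E (τ e) e
    have a2 := bilin_swap E (τ f) f
    have a3 := bilin_swap E f e
    have a4 := bilin_swap E (τ f) e
    have a5 := bilin_swap E f (τ e)
    have a6 := bilin_swap E (τ f) (τ e)
    fin_cases j <;> fin_cases k <;>
      simp [hτ, bilin_self, k1, k2, a1, a2, a3, a4, a5, a6, k5, k6] <;>
      ring
  exact LinearMap.congr_fun₂ hB x y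

/-- Self-adjointness replaces orthogonality from here on: rank, type and sign are all read off from
it. -/
theorem mem_orthogonalComplement_iff (hτ : ∀ γ, τ (τ γ) = -γ - τ γ)
    (hd : b.det ![e, τ e, f, τ f] ≠ 0) {E : H2 Γ} :
    E ∈ orthogonalComplement Γ (invariantClasses Γ τ) ↔
      ∀ x y, bilin E (τ x) y = bilin E x (τ y) := by
  refine ⟨selfAdjoint_of_mem_orthogonalComplement hτ hd, fun hE E' hE' w => ?_⟩
  have h := wedge_eq_zero_of_invariant (e := e) (f := f) hτ hE (mem_invariantClasses_iff.1 hE')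
  rw [wedge_eq_mul_det _ _ b] at h ⊢
  rw [(mul_eq_zero.1 h).resolve_right hd, zero_mul]

theorem finrank_orthogonalComplement (hτ : ∀ γ, τ (τ γ) = -γ - τ γ)
    (hd : b.det ![e, τ e, f, τ f] ≠ 0) :
    Module.finrank ℤ (orthogonalComplement Γ (invariantClasses Γ τ)) = 2 := by
  have h0 := cramerCoords_apply_self b ![e, τ e, f, τ f] 0
  have h2 := cramerCoords_apply_self b ![e, τ e, f, τ f] 2
  have h3 := cramerCoords_apply_self b ![e, τ e, f, τ f] 3
  simp at h0 h2 h3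
  have hc := fun γ => cramerCoords_map hτ hd γ
  set M := orthogonalComplement Γ (invariantClasses Γ τ)
  let ev : M →ₗ[ℤ] (Fin 2 → ℤ) :=
    { toFun := fun E => ![bilin E.1 e f, bilin E.1 e (τ f)]
      map_add' := fun E E' => by ext i; fin_cases i <;> simp [bilin_add]
      map_smul' := fun k E => by ext i; fin_cases i <;> simp [bilin_smul] }
  have hev : Function.Injective ev := fun E E' h =>
    Subtype.ext (eq_of_selfAdjoint hτ hd ((mem_orthogonalComplement_iff hτ hd).1 E.2)
      ((mem_orthogonalComplement_iff hτ hd).1 E'.2) (congrFun h 0) (congrFun h 1))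
  let c : Fin 4 → Γ →ₗ[ℤ] ℤ := fun i =>
    LinearMap.proj i ∘ₗ cramerCoords b ![e, τ e, f, τ f]
  -- For x = c₀ + c₁ω and y = c₂ + c₃ω one has x ∧ y = E₁ + ωE₂. Applying τ in either argument
  -- multiplies x ∧ y by ω, so both components are self-adjoint.
  let E₁ : M := ⟨wedgeForm (c 0) (c 2) - wedgeForm (c 1) (c 3),
    (mem_orthogonalComplement_iff hτ hd).2 fun x y => by
      simp [bilin_sub, c, hc]
      ring⟩
  let E₂ : M := ⟨wedgeForm (c 0) (c 3) + wedgeForm (c 1) (c 2) - wedgeForm (c 1) (c 3),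
    (mem_orthogonalComplement_iff hτ hd).2 fun x y => by
      simp [bilin_sub, bilin_add, c, hc]
      ring⟩
  let g : (Fin 2 → ℤ) →ₗ[ℤ] M := Fintype.linearCombination ℤ ![E₁, E₂]
  have hg : Function.Injective g := by
    rw [← LinearMap.ker_eq_bot, LinearMap.ker_eq_bot']
    intro m hm
    have h := congrArg ev hm
    rw [map_zero] at h
    have k0 := congrFun h 0
    have k1 := congrFun h 1
    simp [g, ev, Fintype.linearCombination_apply, bilin_add, bilin_sub, bilin_smul, E₁, E₂, c,
      h0, h2, h3, hd] at k0 k1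
    ext i; fin_cases i <;> simp [k0, k1]
  have : Module.Finite ℤ M := Module.Finite.of_injective ev hev
  have hle := LinearMap.finrank_le_finrank_of_injective hev
  have hge := LinearMap.finrank_le_finrank_of_injective hg
  rw [Module.finrank_fin_fun] at hle hge
  exact le_antisymm hle hge

end OrderThree

/-! ### The real extension of a form and its type -/

section RealExtension

variable {Γ : Submodule ℤ (Fin 2 → ℂ)} [DiscreteTopology Γ] [IsZLattice ℝ Γ]

theorem exists_basis (Γ : Submodule ℤ (Fin 2 → ℂ)) [DiscreteTopology Γ] [IsZLattice ℝ Γ] :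
    Nonempty (Module.Basis (Fin 4) ℤ Γ) := by
  have := ZLattice.module_finite ℝ Γ
  have := ZLattice.module_free ℝ Γ
  refine ⟨(Module.Free.chooseBasis ℤ Γ).reindex (Fintype.equivOfCardEq ?_)⟩
  rw [← Module.finrank_eq_card_chooseBasisIndex, ZLattice.rank ℝ, Module.finrank_pi_fintype]
  simp

theorem linearMap_ext_of_lattice {N : Type*} [AddCommGroup N] [Module ℝ N]
    {φ ψ : (Fin 2 → ℂ) →ₗ[ℝ] N} (h : ∀ γ : Γ, φ γ = ψ γ) : φ = ψ := by
  obtain ⟨b⟩ := exists_basis Γ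
  exact (b.ofZLatticeBasis ℝ Γ).ext fun i => by simpa using h (b i)

theorem bilinear_ext_of_lattice {N : Type*} [AddCommGroup N] [Module ℝ N]
    {B B' : (Fin 2 → ℂ) →ₗ[ℝ] (Fin 2 → ℂ) →ₗ[ℝ] N} (h : ∀ γ δ : Γ, B γ δ = B' γ δ) :
    B = B' :=
  linearMap_ext_of_lattice fun γ => linearMap_ext_of_lattice fun δ => h γ δ

/-- The real bilinear extension of an integral form. -/
noncomputable def realExt (b : Module.Basis (Fin 4) ℤ Γ) (E : H2 Γ) :
    (Fin 2 → ℂ) →ₗ[ℝ] (Fin 2 → ℂ) →ₗ[ℝ] ℝ :=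
  (b.ofZLatticeBasis ℝ Γ).constr ℝ fun i =>
    (b.ofZLatticeBasis ℝ Γ).constr ℝ fun j => (bilin E (b i) (b j) : ℝ)

omit [DiscreteTopology Γ] [IsZLattice ℝ Γ] in
theorem apply_coe_of_basis (b : Module.Basis (Fin 4) ℤ Γ) {φ : (Fin 2 → ℂ) →ₗ[ℝ] ℝ}
    {ψ : Γ →ₗ[ℤ] ℤ} (h : ∀ i, φ (b i) = ψ (b i)) (γ : Γ) : φ γ = ψ γ := by
  have : φ.restrictScalars ℤ ∘ₗ Γ.subtype = (Int.castAddHom ℝ).toIntLinearMap ∘ₗ ψ :=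
    b.ext fun i => by simpa using h i
  exact LinearMap.congr_fun this γ

theorem realExt_coe (b : Module.Basis (Fin 4) ℤ Γ) (E : H2 Γ) (γ δ : Γ) :
    realExt b E γ δ = bilin E γ δ := by
  refine apply_coe_of_basis b (φ := (realExt b E).flip δ) (ψ := (bilin E).flip δ) (fun i => ?_) γ
  refine apply_coe_of_basis b (φ := realExt b E (b i)) (ψ := bilin E (b i)) (fun j => ?_) δ
  have h := fun i => (b.ofZLatticeBasis ℝ Γ).constr_basis ℝ
    (fun j => (bilin E (b i) (b j) : ℝ))
  have h' := (b.ofZLatticeBasis ℝ Γ).constr_basis ℝ fun i =>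
    (b.ofZLatticeBasis ℝ Γ).constr ℝ fun j => (bilin E (b i) (b j) : ℝ)
  simp only [Module.Basis.ofZLatticeBasis_apply] at h h'
  rw [realExt, h', h]

theorem realExt_add (b : Module.Basis (Fin 4) ℤ Γ) (E E' : H2 Γ) :
    realExt b (E + E') = realExt b E + realExt b E' :=
  bilinear_ext_of_lattice (Γ := Γ) fun γ δ => by simp [realExt_coe, bilin_add]

theorem realExt_swap (b : Module.Basis (Fin 4) ℤ Γ) (E : H2 Γ) (u v : Fin 2 → ℂ) :
    realExt b E u v = -realExt b E v u := by
  have : realExt b E = -(realExt b E).flip :=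
    bilinear_ext_of_lattice (Γ := Γ) fun γ δ => by
      simp only [LinearMap.neg_apply, LinearMap.flip_apply, realExt_coe]
      rw [bilin_swap]; simp
  exact LinearMap.congr_fun₂ this u v

theorem realExt_selfAdjoint (b : Module.Basis (Fin 4) ℤ Γ) {E : H2 Γ} {τ : Γ →ₗ[ℤ] Γ}
    {A : (Fin 2 → ℂ) →L[ℂ] (Fin 2 → ℂ)} (hA : ∀ γ : Γ, (τ γ : Fin 2 → ℂ) = A γ)
    (hE : ∀ x y, bilin E (τ x) y = bilin E x (τ y)) (u v : Fin 2 → ℂ) :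
    realExt b E (A u) v = realExt b E u (A v) := by
  let A' := (A : (Fin 2 → ℂ) →ₗ[ℂ] (Fin 2 → ℂ)).restrictScalars ℝ
  have : realExt b E ∘ₗ A' = (realExt b E).compl₂ A' :=
    bilinear_ext_of_lattice (Γ := Γ) fun γ δ => by
      change realExt b E (A γ) δ = realExt b E γ (A δ)
      rw [← hA, ← hA, realExt_coe, realExt_coe, hE]
  exact LinearMap.congr_fun₂ this u v

end RealExtension

/-! ### Self-adjointness implies type (1,1) -/

section TypeOneOne

variable {A : (Fin 2 → ℂ) →L[ℂ] (Fin 2 → ℂ)} {ℓ m : (Fin 2 → ℂ) →ₗ[ℂ] ℂ}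

namespace IsEigencoords

/-- The basis dual to the eigencoordinates. -/
theorem exists_dual (h : IsEigencoords A ℓ m) :
    ∃ w₁ w₂ : Fin 2 → ℂ, (∀ u, u = ℓ u • w₁ + m u • w₂) ∧ A w₁ = omega • w₁ ∧
      A w₂ = conj omega • w₂ ∧ ℓ w₁ = 1 ∧ m w₁ = 0 ∧ ℓ w₂ = 0 ∧ m w₂ = 1 := by
  have hΔ := h.det_ne_zero
  set Δ := ℓ ![1, 0] * m ![0, 1] - ℓ ![0, 1] * m ![1, 0] with hΔd
  obtain ⟨w₁, hw₁⟩ : ∃ w, w = ![m ![0, 1] / Δ, -m ![1, 0] / Δ] := ⟨_, rfl⟩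
  obtain ⟨w₂, hw₂⟩ : ∃ w, w = ![-ℓ ![0, 1] / Δ, ℓ ![1, 0] / Δ] := ⟨_, rfl⟩
  have hu : ∀ u, u = ℓ u • w₁ + m u • w₂ := by
    intro u
    rw [apply_eq ℓ u, apply_eq m u, hw₁, hw₂]
    ext i
    fin_cases i
    · simp; field_simp; rw [hΔd]; ring
    · simp; field_simp; rw [hΔd]; ring
  have e1 : ℓ w₁ = 1 := by
    rw [apply_eq ℓ w₁, hw₁]; simp; field_simp; rw [hΔd]; ring
  have e2 : m w₁ = 0 := by
    rw [apply_eq m w₁, hw₁]; simp; field_simp; ring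
  have e3 : ℓ w₂ = 0 := by
    rw [apply_eq ℓ w₂, hw₂]; simp; field_simp; ring
  have e4 : m w₂ = 1 := by
    rw [apply_eq m w₂, hw₂]; simp; field_simp; rw [hΔd]; ring
  refine ⟨w₁, w₂, hu, ?_, ?_, e1, e2, e3, e4⟩
  · conv_lhs => rw [hu (A w₁), h.fst_map, h.snd_map, e1, e2]
    simp
  · conv_lhs => rw [hu (A w₂), h.fst_map, h.snd_map, e3, e4]
    simp

end IsEigencoords

variable {B : (Fin 2 → ℂ) →ₗ[ℝ] (Fin 2 → ℂ) →ₗ[ℝ] ℝ}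

theorem omega_smul (x : Fin 2 → ℂ) :
    omega • x = (-1 / 2 : ℝ) • x + (√3 / 2 : ℝ) • (Complex.I • x) := by
  rw [← Complex.coe_smul, ← Complex.coe_smul, smul_smul, ← add_smul]
  congr 1
  apply Complex.ext <;> simp [omega]

theorem conj_omega_smul (x : Fin 2 → ℂ) :
    conj omega • x = (-1 / 2 : ℝ) • x + -((√3 / 2 : ℝ) • (Complex.I • x)) := by
  rw [← neg_smul, ← Complex.coe_smul, ← Complex.coe_smul, smul_smul, ← add_smul]
  congr 1
  apply Complex.ext <;> simp [omega]

/-- An alternating form on the complex line of w is determined by B(w, iw), and the symmetry `hI`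
makes this equal to its own negative. -/
theorem eq_zero_of_apply_I_smul (hswap : ∀ u v, B u v = -B v u) {w : Fin 2 → ℂ}
    (hI : B (Complex.I • w) w = B w (Complex.I • w)) (α β : ℂ) : B (α • w) (β • w) = 0 := by
  have h0 : ∀ u, B u u = 0 := fun u => by linarith [hswap u u]
  have h1 : B w (Complex.I • w) = 0 := by linarith [hswap (Complex.I • w) w]
  have hs : ∀ α : ℂ, α • w = α.re • w + α.im • (Complex.I • w) := by
    intro α
    rw [← Complex.coe_smul, ← Complex.coe_smul, smul_smul, ← add_smul, Complex.re_add_im]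
  rw [hs α, hs β]
  simp [h0, h1, hI]

/-- Since ω and ω̄ are −1/2 ± (√3/2)i, self-adjointness of A becomes a statement about i: on each
eigenline i is self-adjoint, so B vanishes there, and between the two eigenlines B(iu, v) = −B(u,
iv). -/
theorem apply_I_smul_I_smul (h : IsEigencoords A ℓ m) (hswap : ∀ u v, B u v = -B v u)
    (hB : ∀ u v, B (A u) v = B u (A v)) (u v : Fin 2 → ℂ) :
    B (Complex.I • u) (Complex.I • v) = B u v := by
  obtain ⟨w₁, w₂, hu, hw₁, hw₂, -⟩ := h.exists_dual
  have z1 := eq_zero_of_apply_I_smul hswap (w := w₁) (by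
    have := hB w₁ w₁
    rw [hw₁, omega_smul] at this
    simp at this; exact this)
  have z2 := eq_zero_of_apply_I_smul hswap (w := w₂) (by
    have := hB w₂ w₂
    rw [hw₂, conj_omega_smul] at this
    simp at this; exact this)
  have z12 : ∀ α β : ℂ, B (Complex.I • α • w₁) (Complex.I • β • w₂) = B (α • w₁) (β • w₂) := by
    intro α β
    have := hB (α • w₁) (Complex.I • β • w₂)
    rw [A.map_smul, A.map_smul, A.map_smul, hw₁, hw₂, smul_comm α omega, smul_comm β (conj omega),
      smul_comm Complex.I (conj omega), omega_smul, conj_omega_smul, smul_smul Complex.I Complex.I,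
      Complex.I_mul_I] at this
    simp at this
    exact this
  have z21 : ∀ α β : ℂ, B (Complex.I • α • w₂) (Complex.I • β • w₁) = B (α • w₂) (β • w₁) := by
    intro α β
    rw [hswap, z12, ← hswap]
  rw [hu u, hu v]
  simp only [smul_add, map_add, LinearMap.add_apply, z12, z21, z1, z2]
  simp only [smul_smul, z1, z2]

end TypeOneOne

/-! ### Orientation -/

section Orientation

/-- `realCoords` as a linear map. -/
def realCoordsLinear : (Fin 2 → ℂ) →ₗ[ℝ] (Fin 4 → ℝ) where
  toFun := realCoords
  map_add' u v := by ext i; fin_cases i <;> simp [realCoords]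
  map_smul' c u := by ext i; fin_cases i <;> simp [realCoords]

variable {Γ : Submodule ℤ (Fin 2 → ℂ)}

theorem det_realCoords (b : Module.Basis (Fin 4) ℤ Γ) (v : Fin 4 → Γ) :
    Matrix.det (Matrix.of fun i => realCoords (v i : Fin 2 → ℂ)) =
      b.det v * Matrix.det (Matrix.of fun i => realCoords (b i : Fin 2 → ℂ)) := by
  have : Matrix.of (fun i => realCoords (v i : Fin 2 → ℂ)) =
      ((b.toMatrix v).map (Int.cast : ℤ → ℝ)).transpose *
        Matrix.of fun i => realCoords (b i : Fin 2 → ℂ) := by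
    ext i j
    let φ : Γ →ₗ[ℤ] ℝ :=
      (LinearMap.proj j ∘ₗ realCoordsLinear).restrictScalars ℤ ∘ₗ Γ.subtype
    change φ (v i) = _
    rw [← b.sum_repr (v i), map_sum, Matrix.mul_apply]
    exact Finset.sum_congr rfl fun k _ => by
      rw [map_smul, zsmul_eq_mul]; rfl
  rw [this, Matrix.det_mul, Matrix.det_transpose, Module.Basis.det_apply, Int.cast_det]

variable {A : (Fin 2 → ℂ) →L[ℂ] (Fin 2 → ℂ)} {ℓ m : (Fin 2 → ℂ) →ₗ[ℂ] ℂ}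

/-- The determinant of the two eigencoordinates, the second one conjugated. -/
noncomputable def eigenDet (ℓ m : (Fin 2 → ℂ) →ₗ[ℂ] ℂ) (u v : Fin 2 → ℂ) : ℂ :=
  ℓ u * conj (m v) - ℓ v * conj (m u)

/-- A complex linear map of determinant Δ has real determinant |Δ|². -/
theorem det_realCoords_map (ℓ m : (Fin 2 → ℂ) →ₗ[ℂ] ℂ) (v : Fin 4 → Fin 2 → ℂ) :
    Matrix.det (Matrix.of fun i => realCoords ![ℓ (v i), m (v i)]) =
      Matrix.det (Matrix.of fun i => realCoords (v i)) *
        Complex.normSq (ℓ ![1, 0] * m ![0, 1] - ℓ ![0, 1] * m ![1, 0]) := by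
  obtain ⟨a, ha⟩ : ∃ a, a = ℓ ![1, 0] := ⟨_, rfl⟩
  obtain ⟨b, hb⟩ : ∃ a, a = ℓ ![0, 1] := ⟨_, rfl⟩
  obtain ⟨c, hc⟩ : ∃ a, a = m ![1, 0] := ⟨_, rfl⟩
  obtain ⟨d, hd⟩ : ∃ a, a = m ![0, 1] := ⟨_, rfl⟩
  have hR : Matrix.of (fun i => realCoords ![ℓ (v i), m (v i)]) =
      Matrix.of (fun i => realCoords (v i)) *
        !![a.re, a.im, c.re, c.im; -a.im, a.re, -c.im, c.re;
          b.re, b.im, d.re, d.im; -b.im, b.re, -d.im, d.re] := by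
    ext i j
    rw [Matrix.of_apply, IsEigencoords.apply_eq ℓ (v i), IsEigencoords.apply_eq m (v i),
      ← ha, ← hb, ← hc, ← hd]
    fin_cases j <;> simp [Matrix.mul_apply, Fin.sum_univ_four, realCoords] <;> ring
  rw [hR, Matrix.det_mul, ← ha, ← hb, ← hc, ← hd]
  congr 1
  simp [Matrix.det_succ_row_zero, Fin.sum_univ_succ, Fin.succAbove, Complex.normSq_apply]
  ring

/-- In the coordinates (ℓ, m̄), A is multiplication by ω, which gives (Im ω)² = 3/4 times
|`eigenDet`|². Conjugating the second coordinate reverses the orientation, hence the sign. -/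
theorem IsEigencoords.det_realCoords_neg (h : IsEigencoords A ℓ m) {e f : Fin 2 → ℂ}
    (hef : eigenDet ℓ m e f ≠ 0) :
    Matrix.det (Matrix.of fun i => realCoords (![e, A e, f, A f] i)) < 0 := by
  have h3 : √3 ^ 2 = 3 := Real.sq_sqrt (by norm_num)
  have h1 := det_realCoords_map ℓ m ![e, A e, f, A f]
  have h2 : Matrix.det (Matrix.of fun i =>
      realCoords ![ℓ (![e, A e, f, A f] i), m (![e, A e, f, A f] i)]) =
      -(3 / 4) * Complex.normSq (eigenDet ℓ m e f) := by
    simp [Matrix.det_succ_row_zero, Fin.sum_univ_succ, Fin.succAbove, Complex.normSq_apply,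
      realCoords, h.fst_map, h.snd_map, eigenDet, omega]
    ring_nf
    simp only [h3]
    ring
  have hp : 0 < Complex.normSq (eigenDet ℓ m e f) := Complex.normSq_pos.2 hef
  rw [h2] at h1
  have := Complex.normSq_nonneg (ℓ ![1, 0] * m ![0, 1] - ℓ ![0, 1] * m ![1, 0])
  by_contra hcon
  nlinarith [mul_nonneg (not_lt.1 hcon) this]

/-- `eigenDet` is real bilinear and nonzero on the dual basis of (ℓ, m), and Γ spans ℂ² over ℝ. -/
theorem IsEigencoords.exists_eigenDet_ne_zero [DiscreteTopology Γ] [IsZLattice ℝ Γ]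
    (h : IsEigencoords A ℓ m) : ∃ e f : Γ, eigenDet ℓ m e f ≠ 0 := by
  by_contra! hcon
  let θ : (Fin 2 → ℂ) →ₗ[ℝ] (Fin 2 → ℂ) →ₗ[ℝ] ℂ := LinearMap.mk₂ ℝ (eigenDet ℓ m)
    (fun _ _ _ => by simp [eigenDet]; ring)
    (fun c u v => by
      simp only [eigenDet, ← Complex.coe_smul, map_smul, smul_eq_mul, map_mul, Complex.conj_ofReal]
      ring)
    (fun _ _ _ => by simp [eigenDet]; ring)
    (fun c u v => by
      simp only [eigenDet, ← Complex.coe_smul, map_smul, smul_eq_mul, map_mul, Complex.conj_ofReal]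
      ring)
  have h0 : θ = 0 := bilinear_ext_of_lattice (Γ := Γ) fun γ δ => hcon γ δ
  obtain ⟨w₁, w₂, -, -, -, e1, e2, e3, e4⟩ := h.exists_dual
  have : eigenDet ℓ m w₁ w₂ = 0 := LinearMap.congr_fun₂ h0 w₁ w₂
  simp [eigenDet, e1, e2, e3, e4] at this

end Orientation

/-! ### Line bundles from factors of automorphy -/

section Factor

variable {Γ : Submodule ℤ (Fin 2 → ℂ)}

/-- The real form `B` is alternating of type `(1,1)`, and integral on `Γ`. -/
structure IsNeronSeveriForm (Γ : Submodule ℤ (Fin 2 → ℂ))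
    (B : (Fin 2 → ℂ) →ₗ[ℝ] (Fin 2 → ℂ) →ₗ[ℝ] ℝ) : Prop where
  swap : ∀ u v, B u v = -B v u
  I_smul : ∀ u v, B (Complex.I • u) (Complex.I • v) = B u v
  integral : ∀ γ ∈ Γ, ∀ δ ∈ Γ, ∃ n : ℤ, B γ δ = n

/-- The `ℂ`-linear form `v ↦ -i H(v, γ)`, where `H` is the hermitian form with imaginary
part `B`. -/
noncomputable def hermitianForm (B : (Fin 2 → ℂ) →ₗ[ℝ] (Fin 2 → ℂ) →ₗ[ℝ] ℝ) (γ : Fin 2 → ℂ) :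
    (Fin 2 → ℂ) →ₗ[ℂ] ℂ where
  toFun v := (B v γ : ℂ) - Complex.I * (B (Complex.I • v) γ : ℂ)
  map_add' u v := by simp; ring
  map_smul' c v := by
    have hs : ∀ w : Fin 2 → ℂ, c • w = c.re • w + c.im • (Complex.I • w) := by
      intro w
      rw [← Complex.coe_smul, ← Complex.coe_smul, smul_smul, ← add_smul, Complex.re_add_im]
    rw [smul_comm Complex.I c, hs v, hs (Complex.I • v), smul_smul Complex.I Complex.I]
    rw [RingHom.id_apply, smul_eq_mul]
    simp
    linear_combination ((B v γ : ℂ) - Complex.I * (B (Complex.I • v) γ : ℂ)) *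
      Complex.re_add_im c + ((c.im : ℂ) * (B (Complex.I • v) γ : ℂ)) * Complex.I_sq

/-- The exponent of the factor of automorphy attached to `2 B`. -/
noncomputable def exponent (B : (Fin 2 → ℂ) →ₗ[ℝ] (Fin 2 → ℂ) →ₗ[ℝ] ℝ) (γ v : Fin 2 → ℂ) : ℂ :=
  hermitianForm B γ v - Complex.I / 2 * (B (Complex.I • γ) γ : ℂ)

/-- The factor of automorphy attached to `2 B`. -/
noncomputable def factor (B : (Fin 2 → ℂ) →ₗ[ℝ] (Fin 2 → ℂ) →ₗ[ℝ] ℝ) (γ v : Fin 2 → ℂ) : ℂˣ :=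
  Units.mk0 (Complex.exp (2 * Real.pi * Complex.I * exponent B γ v)) (Complex.exp_ne_zero _)

variable {B : (Fin 2 → ℂ) →ₗ[ℝ] (Fin 2 → ℂ) →ₗ[ℝ] ℝ}

theorem coe_factor (B : (Fin 2 → ℂ) →ₗ[ℝ] (Fin 2 → ℂ) →ₗ[ℝ] ℝ) (γ v : Fin 2 → ℂ) :
    (factor B γ v : ℂ) = Complex.exp (2 * Real.pi * Complex.I * exponent B γ v) := rfl

theorem factor_add_form (B B' : (Fin 2 → ℂ) →ₗ[ℝ] (Fin 2 → ℂ) →ₗ[ℝ] ℝ) (γ v : Fin 2 → ℂ) :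
    factor (B + B') γ v = factor B γ v * factor B' γ v := by
  ext
  rw [Units.val_mul, coe_factor, coe_factor, coe_factor, ← Complex.exp_add]
  congr 1
  simp [exponent, hermitianForm]
  ring

theorem differentiable_exponent (B : (Fin 2 → ℂ) →ₗ[ℝ] (Fin 2 → ℂ) →ₗ[ℝ] ℝ) (γ : Fin 2 → ℂ) :
    Differentiable ℂ (exponent B γ) :=
  (hermitianForm B γ).toContinuousLinearMap.differentiable.sub_const _

theorem differentiable_factor (B : (Fin 2 → ℂ) →ₗ[ℝ] (Fin 2 → ℂ) →ₗ[ℝ] ℝ) (γ : Fin 2 → ℂ) :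
    Differentiable ℂ fun v => (factor B γ v : ℂ) :=
  ((differentiable_exponent B γ).const_mul _).cexp

/-- The exponent is −iH(v, γ) − (i/2)H(γ, γ), and the cocycle rule holds up to the integer B(δ, γ),
which the exponential kills. Working with 2B dispenses with the semicharacter that B itself would
need. -/
theorem IsNeronSeveriForm.factor_add (hB : IsNeronSeveriForm Γ B) {γ δ : Fin 2 → ℂ}
    (hγ : γ ∈ Γ) (hδ : δ ∈ Γ) (v : Fin 2 → ℂ) :
    factor B (γ + δ) v = factor B γ (v + δ) * factor B δ v := by
  obtain ⟨n, hn⟩ := hB.integral δ hδ γ hγ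
  ext
  rw [Units.val_mul, coe_factor, coe_factor, coe_factor, ← Complex.exp_add,
    Complex.exp_eq_exp_iff_exists_int]
  refine ⟨-n, ?_⟩
  have hsymm : B (Complex.I • γ) δ = B (Complex.I • δ) γ := by
    rw [← hB.I_smul, smul_smul, Complex.I_mul_I, hB.swap]
    simp
  have hn' : (n : ℂ) = (B δ γ : ℂ) := by rw [hn]; simp
  push_cast
  rw [hn']
  simp [exponent, hermitianForm, hsymm]
  ring

/-! ### Local inverses of the projection -/

/-- Sections `s x` of the projection which are continuous on `U x`. -/
structure IsLocalSection (Γ : Submodule ℤ (Fin 2 → ℂ)) (U : Torus Γ → Set (Torus Γ))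
    (s : Torus Γ → Torus Γ → Fin 2 → ℂ) : Prop where
  cover : IsPointedCover Γ U
  proj_apply : ∀ x p, proj Γ (s x p) = p
  eventually_eq : ∀ x v, proj Γ v ∈ U x →
    ∀ᶠ w in 𝓝 v, s x (proj Γ w) = w + (s x (proj Γ v) - v)

/-- If nonzero lattice vectors have norm at least r, a ball of radius r/2 contains no two points
congruent modulo Γ, so the projection is injective on it. Outside the image of the ball any preimage
will do. -/
theorem exists_isLocalSection (Γ : Submodule ℤ (Fin 2 → ℂ)) [DiscreteTopology Γ] :
    ∃ U s, IsLocalSection Γ U s := by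
  obtain ⟨r, hr, h0⟩ := exists_pos_norm_lt_imp_eq_zero Γ
  choose o ho using proj_surjective Γ
  have hs : ∀ x p, ∃ w, proj Γ w = p ∧
      (p ∈ proj Γ '' Metric.ball (o x) (r / 2) → w ∈ Metric.ball (o x) (r / 2)) := by
    intro x p
    by_cases hp : p ∈ proj Γ '' Metric.ball (o x) (r / 2)
    · obtain ⟨w, hw, hwp⟩ := hp
      exact ⟨w, hwp, fun _ => hw⟩
    · exact ⟨o p, ho p, fun h => absurd h hp⟩
  choose s hs1 hs2 using hs
  refine ⟨fun x => proj Γ '' Metric.ball (o x) (r / 2), s, fun x =>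
    ⟨isOpenMap_proj Γ _ Metric.isOpen_ball, o x, Metric.mem_ball_self (by positivity), ho x⟩,
    hs1, fun x v hv => ?_⟩
  have hcont : ContinuousAt (fun w => w + (s x (proj Γ v) - v)) v := by fun_prop
  have hmem : v + (s x (proj Γ v) - v) ∈ Metric.ball (o x) (r / 2) := by
    simpa using hs2 x _ hv
  filter_upwards [hcont (Metric.isOpen_ball.mem_nhds hmem)] with w hw
  have hΓ : s x (proj Γ v) - v ∈ Γ := by rw [← proj_eq_iff, hs1]
  have hw' := hs2 x (proj Γ w) ⟨_, hw, proj_add_mem Γ w hΓ⟩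
  have hΓ' : s x (proj Γ w) - w ∈ Γ := by rw [← proj_eq_iff, hs1]
  refine sub_eq_zero.1 (h0 _ ?_ ?_)
  · rw [← sub_sub]
    exact Γ.sub_mem hΓ' hΓ
  · rw [← dist_eq_norm]
    have h1 := Metric.mem_ball.1 hw
    have h2 := Metric.mem_ball.1 hw'
    have h3 := dist_triangle_right (s x (proj Γ w)) (w + (s x (proj Γ v) - v)) (o x)
    simp only at h1
    linarith

variable {U : Torus Γ → Set (Torus Γ)} {s : Torus Γ → Torus Γ → Fin 2 → ℂ}

/-- The transition functions of the line bundle with the given factor of automorphy. -/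
noncomputable def factorCocycle (s : Torus Γ → Torus Γ → Fin 2 → ℂ)
    (B : (Fin 2 → ℂ) →ₗ[ℝ] (Fin 2 → ℂ) →ₗ[ℝ] ℝ) : Torus Γ → Torus Γ → Torus Γ → ℂˣ :=
  fun x y p => factor B (s x p - s y p) (s y p)

theorem factorCocycle_add (s : Torus Γ → Torus Γ → Fin 2 → ℂ)
    (B B' : (Fin 2 → ℂ) →ₗ[ℝ] (Fin 2 → ℂ) →ₗ[ℝ] ℝ) :
    factorCocycle s (B + B') = factorCocycle s B * factorCocycle s B' := by
  ext x y p : 3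
  exact factor_add_form _ _ _ _

theorem IsLocalSection.sub_mem (hs : IsLocalSection Γ U s) (x y p : Torus Γ) :
    s x p - s y p ∈ Γ := by
  rw [← proj_eq_iff, hs.proj_apply, hs.proj_apply]

theorem IsNeronSeveriForm.factorCocycle_mem (hB : IsNeronSeveriForm Γ B)
    (hs : IsLocalSection Γ U s) : factorCocycle s B ∈ holomorphicCocycles Γ := by
  refine ⟨U, hs.cover, fun x y v hv => ?_, fun x y z p _ => ?_⟩
  · refine DifferentiableAt.differentiableWithinAt ?_
    have hd : DifferentiableAt ℂ (fun w => (factor B (s x (proj Γ v) - s y (proj Γ v))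
        (w + (s y (proj Γ v) - v)) : ℂ)) v :=
      ((differentiable_factor B _).comp (differentiable_id.add_const _)) v
    refine hd.congr_of_eventuallyEq ?_
    filter_upwards [hs.eventually_eq x v hv.1, hs.eventually_eq y v hv.2] with w h1 h2
    simp only [factorCocycle]
    rw [h1, h2]
    congr 2
    abel
  · have := hB.factor_add (hs.sub_mem x y p) (hs.sub_mem y z p) (s z p)
    simp only [sub_add_sub_cancel, add_sub_cancel] at this
    exact this.symm

theorem eq_of_exp_eq_one {g : (Fin 2 → ℂ) → ℂ} (hg : Continuous g)
    (h : ∀ v, Complex.exp (g v) = 1) (v w : Fin 2 → ℂ) : g v = g w := by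
  have := (Complex.isCoveringMapOn_exp.existsUnique_continuousMap_lifts
    (ContinuousMap.const (Fin 2 → ℂ) (1 : ℂ)) (a₀ := w) (e₀ := g w) (h w) (by simp)).unique
    (y₁ := ⟨g, hg⟩) (y₂ := ContinuousMap.const _ (g w)) ⟨rfl, funext h⟩
    ⟨rfl, funext fun _ => h w⟩
  exact congrArg (fun F : C(Fin 2 → ℂ, ℂ) => F v) this

/-- If a continuous nowhere vanishing function is multiplied by the factor of automorphy under
translations by `Γ`, then the form vanishes on `Γ`. -/
theorem IsNeronSeveriForm.eq_zero_of_automorphic (hB : IsNeronSeveriForm Γ B)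
    {φ : (Fin 2 → ℂ) → ℂ} (hφ : Continuous φ) (h0 : ∀ v, φ v ≠ 0)
    (h : ∀ v, ∀ γ ∈ Γ, φ (v + γ) = factor B γ v * φ v) {γ δ : Fin 2 → ℂ}
    (hγ : γ ∈ Γ) (hδ : δ ∈ Γ) : B γ δ = 0 := by
  obtain ⟨L, ⟨-, hL⟩, -⟩ := Complex.isCoveringMapOn_exp.existsUnique_continuousMap_lifts
    ⟨φ, hφ⟩ (a₀ := 0) (e₀ := Complex.log (φ 0)) (Complex.exp_log (h0 0))
    (fun v => by simpa using h0 v)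
  have hL : ∀ v, Complex.exp (L v) = φ v := fun v => congrFun hL v
  -- L is a continuous logarithm of φ. The automorphy of φ says that the exponential of the left
  -- side is 1, so that side is constant in v.
  have key : ∀ γ ∈ Γ, ∀ v, L (v + γ) - L v - 2 * Real.pi * Complex.I * exponent B γ v =
      L (0 + γ) - L 0 - 2 * Real.pi * Complex.I * exponent B γ 0 := by
    intro γ hγ v
    have hc := (differentiable_exponent B γ).continuous
    refine eq_of_exp_eq_one
      (g := fun v => L (v + γ) - L v - 2 * Real.pi * Complex.I * exponent B γ v)
      (by fun_prop) (fun v => ?_) v 0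
    rw [Complex.exp_sub, Complex.exp_sub, hL, hL, h v γ hγ, ← coe_factor]
    field_simp [h0 v, (factor B γ v).ne_zero]
  have h1 := key γ hγ δ
  have h2 := key δ hδ γ
  rw [add_comm δ γ] at h1
  simp only [zero_add] at h1 h2
  -- L(γ + δ) is computed in the two orders of translation. The real part of the identity reads B(δ,
  -- γ) = B(γ, δ), so the alternating form vanishes.
  have h3 : exponent B γ δ - exponent B γ 0 = exponent B δ γ - exponent B δ 0 := by
    have h4 : (2 * Real.pi * Complex.I : ℂ) ≠ 0 := by simp [Real.pi_ne_zero]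
    refine mul_left_cancel₀ h4 ?_
    linear_combination h2 - h1
  have h5 := congrArg Complex.re h3
  simp [exponent, hermitianForm] at h5
  linarith [hB.swap γ δ]

theorem IsNeronSeveriForm.eq_zero_of_mem_continuousCoboundaries (hB : IsNeronSeveriForm Γ B)
    (hs : IsLocalSection Γ U s) (hg : factorCocycle s B ∈ continuousCoboundaries Γ)
    {γ δ : Fin 2 → ℂ} (hγ : γ ∈ Γ) (hδ : δ ∈ Γ) : B γ δ = 0 := by
  obtain ⟨U', hU', h, hc, hh⟩ := hg
  -- The local trivialization `h x`, transported from the point s x (proj v) to v by the factor of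
  -- automorphy. These agree on overlaps and glue to a global automorphic function.
  let ψ : Torus Γ → (Fin 2 → ℂ) → ℂˣ := fun x v =>
    factor B (v - s x (proj Γ v)) (s x (proj Γ v)) * h x (proj Γ v)
  have hmem : ∀ x v, v - s x (proj Γ v) ∈ Γ := fun x v => by
    rw [← proj_eq_iff, hs.proj_apply]
  have hψ : ∀ x y v, proj Γ v ∈ U' x ∩ U' y → ψ x v = ψ y v := by
    intro x y v hv
    have h1 := hh x y _ hv
    have h2 := hB.factor_add (hmem x v) (hs.sub_mem x y (proj Γ v)) (s y (proj Γ v))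
    simp only [sub_add_sub_cancel, add_sub_cancel] at h2
    rw [eq_div_iff_mul_eq'] at h1
    simp only [ψ]
    rw [h2, ← h1, factorCocycle, ← mul_assoc, mul_right_comm]
  refine hB.eq_zero_of_automorphic (φ := fun v => (ψ (proj Γ v) v : ℂ)) ?_
    (fun v => (ψ (proj Γ v) v).ne_zero) (fun v γ hγ => ?_) hγ hδ
  · rw [continuous_iff_continuousAt]
    intro v
    set x := proj Γ v with hx
    have hc1 : ContinuousAt (fun w => (h x (proj Γ w) : ℂ)) v :=
      Units.continuous_val.continuousAt.comp
        (((hc x).continuousAt ((hU' x).1.mem_nhds (hU' x).2)).comp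
          (continuous_proj Γ).continuousAt)
    have hc2 : ContinuousAt (fun w => (factor B (v - s x x) (w + (s x x - v)) : ℂ)) v :=
      ((differentiable_factor B _).continuous.comp
        (continuous_id.add continuous_const)).continuousAt
    refine (hc2.mul hc1).congr ?_
    have hU : ∀ᶠ w in 𝓝 v, proj Γ w ∈ U' x :=
      (continuous_proj Γ).continuousAt ((hU' x).1.mem_nhds (hU' x).2)
    filter_upwards [hU, hs.eventually_eq x v (hs.cover x).2] with w hw hw'
    rw [hψ (proj Γ w) x w ⟨(hU' _).2, hw⟩]
    rw [← hx] at hw'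
    have hw2 : w - s x (proj Γ w) = v - s x x := by rw [hw']; abel
    simp only [ψ, Units.val_mul, hw2]
    rw [hw']
    rfl
  · simp only [ψ, proj_add_mem Γ v hγ]
    have := hB.factor_add hγ (hmem (proj Γ v) v) (s (proj Γ v) (proj Γ v))
    rw [add_sub_cancel, ← add_sub_assoc, add_comm γ v] at this
    rw [this]
    simp only [Units.val_mul, mul_assoc]

end Factor

/-! ### The map to the Néron-Severi group -/

section NeronSeveri

variable {Γ : Submodule ℤ (Fin 2 → ℂ)}

theorem IsHolomorphicOn.continuousOn {f : Torus Γ → ℂˣ} {U : Set (Torus Γ)} (hU : IsOpen U)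
    (hf : IsHolomorphicOn Γ f U) : ContinuousOn f U := by
  intro p hp
  obtain ⟨v, rfl⟩ := proj_surjective Γ p
  refine ContinuousAt.continuousWithinAt ?_
  have h1 : ContinuousAt (fun w => (f (proj Γ w) : ℂ)) v :=
    (DifferentiableOn.continuousOn hf).continuousAt ((hU.preimage (continuous_proj Γ)).mem_nhds hp)
  rw [Units.isEmbedding_val₀.continuousAt_iff, ContinuousAt,
    ← (isOpenMap_proj Γ).map_nhds_eq (continuous_proj Γ).continuousAt, tendsto_map'_iff]
  exact h1

theorem holomorphicCoboundaries_le_continuousCoboundaries (Γ : Submodule ℤ (Fin 2 → ℂ)) :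
    holomorphicCoboundaries Γ ≤ continuousCoboundaries Γ := by
  rintro g ⟨U, hU, h, h1, h2⟩
  exact ⟨U, hU, h, fun x => (h1 x).continuousOn (hU x).1, h2⟩

/-- The class in the Néron-Severi group of a line bundle. -/
noncomputable def NeronSeveri.mk (Γ : Submodule ℤ (Fin 2 → ℂ)) :
    holomorphicCocycles Γ →* NeronSeveri Γ :=
  (QuotientGroup.mk' (Pic₀ Γ)).comp (Pic.mk Γ)

theorem NeronSeveri.mem_of_mk_eq_one {g : holomorphicCocycles Γ}
    (hg : NeronSeveri.mk Γ g = 1) : (g : Torus Γ → Torus Γ → Torus Γ → ℂˣ) ∈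
      continuousCoboundaries Γ := by
  have h : Pic.mk Γ g ∈ Pic₀ Γ := (QuotientGroup.eq_one_iff _).1 hg
  obtain ⟨g', hg', hgg'⟩ := h
  have h1 : (g'⁻¹ * g) ∈ (holomorphicCoboundaries Γ).subgroupOf (holomorphicCocycles Γ) :=
    QuotientGroup.eq.1 hgg'
  have h2 := holomorphicCoboundaries_le_continuousCoboundaries Γ (Subgroup.mem_subgroupOf.1 h1)
  have h3 := (continuousCoboundaries Γ).mul_mem (Subgroup.mem_subgroupOf.1 hg') h2
  simpa using h3

/-- A subgroup of forms of type `(1,1)` embeds into the Néron-Severi group. -/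
theorem exists_injective_neronSeveri [DiscreteTopology Γ] [IsZLattice ℝ Γ]
    (b : Module.Basis (Fin 4) ℤ Γ) (M : Submodule ℤ (H2 Γ))
    (hM : ∀ E ∈ M, IsNeronSeveriForm Γ (realExt b E)) :
    ∃ g : M →ₗ[ℤ] Additive (NeronSeveri Γ), Function.Injective g := by
  obtain ⟨U, s, hs⟩ := exists_isLocalSection Γ
  let g : M →+ Additive (NeronSeveri Γ) := AddMonoidHom.mk'
    (fun E => Additive.ofMul (NeronSeveri.mk Γ
      ⟨factorCocycle s (realExt b E.1), (hM E.1 E.2).factorCocycle_mem hs⟩))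
    (fun E E' => by
      rw [← ofMul_mul, ← map_mul]
      congr 2
      exact Subtype.ext ((congrArg (factorCocycle s) (realExt_add b E.1 E'.1)).trans
        (factorCocycle_add s _ _)))
  refine ⟨g.toIntLinearMap, (injective_iff_map_eq_zero g).2 fun E hE => ?_⟩
  have h := NeronSeveri.mem_of_mk_eq_one (Γ := Γ) hE
  refine Subtype.ext (bilin_injective (LinearMap.ext₂ fun x y => ?_))
  have h0 := (hM E.1 E.2).eq_zero_of_mem_continuousCoboundaries hs h x.2 y.2
  rw [realExt_coe] at h0
  exact_mod_cast h0

end NeronSeveri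

end ComplexTwoTorus

/-! ### Assembly: rank, type and sign of the complement -/

open ComplexTwoTorus in
theorem mainTheorem11 (Γ : Submodule ℤ (Fin 2 → ℂ)) [DiscreteTopology Γ] [IsZLattice ℝ Γ]
    (t : Equiv.Perm (ComplexTwoTorus.Torus Γ))
    (ht : ComplexTwoTorus.IsSymplecticOrderThree Γ t) :
    2 ≤ Module.rank ℤ (Additive (ComplexTwoTorus.NeronSeveri Γ)) ∧
    (∃! τ : Γ →ₗ[ℤ] Γ, ComplexTwoTorus.IsInducedOnH₁ Γ t τ) ∧
    ∀ τ : Γ →ₗ[ℤ] Γ, ComplexTwoTorus.IsInducedOnH₁ Γ t τ →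
      Module.finrank ℤ (ComplexTwoTorus.orthogonalComplement Γ
        (ComplexTwoTorus.invariantClasses Γ τ)) = 2 ∧
      ∀ E ∈ ComplexTwoTorus.orthogonalComplement Γ (ComplexTwoTorus.invariantClasses Γ τ),
        ComplexTwoTorus.IsTypeOneOne Γ E ∧
        (E ≠ 0 → ∀ b : Module.Basis (Fin 4) ℤ Γ, ComplexTwoTorus.IsPositivelyOriented Γ b →
          ComplexTwoTorus.wedge Γ E E b < 0) := by
  obtain ⟨A, hA⟩ := ht.holomorphic.exists_linear_lift ht.fixes_origin
  obtain ⟨ℓ, m, hℓm⟩ := ht.exists_eigencoords hA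
  obtain ⟨e, f, hef⟩ := hℓm.exists_eigenDet_ne_zero (Γ := Γ)
  have hdet := hℓm.det_realCoords_neg hef
  have hex := existsUnique_isInducedOnH₁ ht hA
  have hind : ∀ τ : Γ →ₗ[ℤ] Γ, IsInducedOnH₁ Γ t τ → ∀ γ : Γ, (τ γ : Fin 2 → ℂ) = A γ :=
    fun τ hτ => hτ.coe_eq hA
  have hsq : ∀ τ : Γ →ₗ[ℤ] Γ, IsInducedOnH₁ Γ t τ → ∀ γ, τ (τ γ) = -γ - τ γ := by
    intro τ hτ γ
    apply Subtype.ext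
    rw [hind τ hτ, hind τ hτ, ht.sq_add hA]
    simp [hind τ hτ]
  have hdet' : ∀ τ : Γ →ₗ[ℤ] Γ, IsInducedOnH₁ Γ t τ → ∀ b : Module.Basis (Fin 4) ℤ Γ,
      b.det ![e, τ e, f, τ f] *
        Matrix.det (Matrix.of fun i => realCoords (b i : Fin 2 → ℂ)) < 0 := by
    intro τ hτ b
    rw [← det_realCoords]
    convert! hdet using 4 with i
    fin_cases i <;> simp [hind τ hτ]
  have hd : ∀ τ : Γ →ₗ[ℤ] Γ, IsInducedOnH₁ Γ t τ → ∀ b : Module.Basis (Fin 4) ℤ Γ,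
      b.det ![e, τ e, f, τ f] ≠ 0 := by
    intro τ hτ b h0
    have := hdet' τ hτ b
    rw [h0] at this
    simp at this
  obtain ⟨b⟩ := exists_basis Γ
  have hNS : ∀ τ : Γ →ₗ[ℤ] Γ, IsInducedOnH₁ Γ t τ →
      ∀ E ∈ orthogonalComplement Γ (invariantClasses Γ τ), IsNeronSeveriForm Γ (realExt b E) := by
    intro τ hτ E hE
    have hE' := (mem_orthogonalComplement_iff (hsq τ hτ) (hd τ hτ b)).1 hE
    exact ⟨realExt_swap b E, apply_I_smul_I_smul hℓm (realExt_swap b E)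
      (realExt_selfAdjoint b (hind τ hτ) hE'),
      fun γ hγ δ hδ => ⟨_, realExt_coe b E ⟨γ, hγ⟩ ⟨δ, hδ⟩⟩⟩
  have hrank : ∀ τ : Γ →ₗ[ℤ] Γ, IsInducedOnH₁ Γ t τ →
      Module.finrank ℤ (orthogonalComplement Γ (invariantClasses Γ τ)) = 2 :=
    fun τ hτ => finrank_orthogonalComplement (hsq τ hτ) (hd τ hτ b)
  refine ⟨?_, hex, fun τ hτ => ⟨hrank τ hτ, fun E hE => ⟨?_, fun hE0 b' hb' => ?_⟩⟩⟩
  · obtain ⟨τ, hτ, -⟩ := hex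
    obtain ⟨g, hg⟩ := exists_injective_neronSeveri b _ (hNS τ hτ)
    refine le_trans ?_ (LinearMap.rank_le_of_injective g hg)
    have h2 := hrank τ hτ
    rw [Module.finrank] at h2
    -- An infinite rank would have `finrank` 0, so the value 2 determines the cardinal rank.
    have h3 := (Cardinal.toNat_eq_iff two_ne_zero).1 h2
    rw [h3]; rfl
  · exact ⟨realExt b E, fun γ δ => realExt_coe b E γ δ, (hNS τ hτ E hE).I_smul⟩
  · have hE' := (mem_orthogonalComplement_iff (hsq τ hτ) (hd τ hτ b')).1 hE
    have h1 := wedge_self_of_selfAdjoint (e := e) (f := f) (hsq τ hτ) hE'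
    rw [wedge_eq_mul_det _ _ b'] at h1
    have h2 : b'.det ![e, τ e, f, τ f] < 0 := by
      have := neg_of_mul_neg_left (hdet' τ hτ b') hb'.le
      exact_mod_cast this
    have h3 : 0 < 2 * (bilin E e f ^ 2 + bilin E e f * bilin E e (τ f) +
        bilin E e (τ f) ^ 2) := by
      by_contra hcon
      have h4 : bilin E e f = 0 := by
        -- 4(a² + ac + c²) = 3a² + (a + 2c)².
        nlinarith [sq_nonneg (bilin E e f), sq_nonneg (bilin E e f + 2 * bilin E e (τ f))]
      have h5 : bilin E e (τ f) = 0 := by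
        rw [h4] at hcon
        nlinarith [sq_nonneg (bilin E e (τ f))]
      exact hE0 (eq_of_selfAdjoint (hsq τ hτ) (hd τ hτ b') hE' (fun _ _ => rfl) h4 h5)
    rw [← h1] at h3
    exact neg_of_mul_pos_left h3 h2.le
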